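/- Let $n\ge 1$, $T=T^{n-1}=(S^1)^{n-1}$, $H_1(T;\mathbb Z)=\mathbb Z^{n-1}$. Let $M$ be a closed topological $(n-1)$-manifold with a regular simple cell structure: a regular CW structure with cells of dimension at most $n-1$ in which every $k$-dimensional cell is contained in exactly $n-k$ maximal cells. Put $Q_M=M\times D^2$ and let $Z_M=M_{n-2}\times\{0\}\subset Q_M$ be the $(n-2)$-skeleton. Consider a compact smooth $2n$-manifold $X$ with boundary and an effective smooth action of $T$ on $X$ such that * the action is strictly appropriate: the fixed point set is finite; every stabilizer is a torus; and for every closed subgroup $H\ne T$ the closure of every connected component of $\{x\in X: T_x=H\}$ contains a point $x'$ with $\dim T_{x'}>\dim H$; * the action is in general position: at each fixed point any $n-1$ of the $n$ weights of the tangent representation are linearly independent; * the action is free on $\partial X$; * the characteristic data of the action are $(Q_M,Z_M,\mu_M,e_M)$. That is, the orbit space $X/T$ is identified by a homeomorphism with $Q_M$ so that $\partial X/T=M\times\partial D^2$ and $Z_M$ is the set of orbits of dimension at most $n-2$; $\mu_M$ assigns to each $(n-2)$-cell of $Z_M$ the (arbitrarily oriented) circle subgroup stabilizing the points over its interior; and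 $e_M\in H^2(Q_M\setminus Z_M;\mathbb Z^{n-1})$ is the Euler class of the principal $T$-bundle formed by the free orbits over $Q_M\setminus Z_M$; * the principal $T$-bundle $\partial X\to\partial X/T= M\times\partial D^2$ is trivial. For $x\in Z_M$ let $e_x$ be the local class of $e_M$ at $x$, i.e. the restriction of $e_M$ to $H^2(U_x\setminus Z_M;\mathbb Z^{n-1})$ for small open neighborhoods $U_x$ of $x$ in $Q_M$. Then $e_M$ is uniquely determined by the local classes $e_x$, $x\in Z_M$: if two such actions, on $X$ and $X'$, have characteristic data $(Q_M,Z_M,\mu_M,e_M)$ and $(Q_M,Z_M,\mu_M',e_M')$ over the same $M$ with the same cell structure, and $e_x=e'_x$ for all $x\in Z_M$, then $e_M=e_M'$. -/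

import Mathlib

open scoped Manifold ContDiff

/-! ### The compact torus -/

/-- The compact torus `T^m`. -/
abbrev Torus (m : ℕ) : Type := Fin m → Circle

/-- The exponential covering `ℝ^m → T^m`, `v ↦ (exp (i v_j))_j`, whose kernel is `2π ℤ^m`; it
identifies `H_1(T^m)` with `ℤ^m`. -/
noncomputable def torusExp {m : ℕ} (v : Fin m → ℝ) : Torus m := fun j => Circle.exp (v j)

/-- The Lie algebra of a subgroup `H` of `T^m`: all `v` whose one-parameter group lies in `H`. -/
noncomputable def torusLieAlgebra {m : ℕ} (H : Subgroup (Torus m)) : Submodule ℝ (Fin m → ℝ) where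
  carrier := {v | ∀ s : ℝ, torusExp (s • v) ∈ H}
  add_mem' := by
    intro v w hv hw s
    have h : torusExp (s • (v + w)) = torusExp (s • v) * torusExp (s • w) := by
      funext j
      simp [torusExp, mul_add, Circle.exp_add]
    rw [h]
    exact H.mul_mem (hv s) (hw s)
  zero_mem' := by
    intro s
    have h : torusExp (s • (0 : Fin m → ℝ)) = 1 := by
      funext j
      simp [torusExp]
    rw [h]
    exact H.one_mem
  smul_mem' := by
    intro a v hv s
    rw [smul_smul]
    exact hv (s * a)

/-- The dimension of a (closed) subgroup of the torus. -/
noncomputable def torusDim {m : ℕ} (H : Subgroup (Torus m)) : ℕ :=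
  Module.finrank ℝ (torusLieAlgebra H)

/-- The character `t ↦ ∏ t_j ^ α_j` of `T^m` with exponent vector `α ∈ ℤ^m = Hom(T^m, S^1)`. -/
noncomputable def torusCharacter {m : ℕ} (α : Fin m → ℤ) (t : Torus m) : Circle :=
  ∏ j, t j ^ α j

/-- The one-parameter subgroup `z ↦ (z ^ v_j)_j` with direction `v ∈ ℤ^m = Hom(S^1, T^m)`. -/
noncomputable def torusCocharacter {m : ℕ} (v : Fin m → ℤ) : Circle →* Torus m where
  toFun z := fun j => z ^ v j
  map_one' := by funext j; simp
  map_mul' z w := by funext j; simp [mul_zpow]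

/-! ### Torus actions of complexity one on manifolds with boundary -/

section Actions

variable (n : ℕ) [NeZero n] (X : Type*) [TopologicalSpace X]
  [ChartedSpace (EuclideanHalfSpace (2 * n)) X] [MulAction (Torus (n - 1)) X]

/-- The action `T^{n-1} × X → X` is smooth. Since `torusExp` is a surjective local diffeomorphism,
this is tested on `ℝ^{n-1} × X`. -/
def IsSmoothTorusAction : Prop :=
  ContMDiff (𝓘(ℝ, Fin (n - 1) → ℝ).prod (𝓡∂ (2 * n))) (𝓡∂ (2 * n)) ∞
    (fun p : (Fin (n - 1) → ℝ) × X => torusExp p.1 • p.2)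



variable {n X} in
/-- `α_1, …, α_n ∈ ℤ^{n-1}` are weights of the tangent representation at the fixed point `x`:
`T_x X ≅ V(α_1) ⊕ ⋯ ⊕ V(α_n)` as real representations. -/
def IsTangentWeights (x : X) (α : Fin n → Fin (n - 1) → ℤ) : Prop :=
  ∃ φ : EuclideanSpace ℝ (Fin (2 * n)) ≃ₗ[ℝ] (Fin n → ℂ),
    ∀ (t : Torus (n - 1)) (w : TangentSpace (𝓡∂ (2 * n)) x) (i : Fin n),
      φ (mfderiv (𝓡∂ (2 * n)) (𝓡∂ (2 * n)) (fun y : X => t • y) x w) i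
        = (torusCharacter (α i) t : ℂ) * φ w i

/-- A strictly appropriate smooth action in general position of `T^{n-1}` on a compact
`2n`-manifold `X` with boundary, free on the boundary. -/
structure IsComplexityOneAction : Prop where
  /-- the action is smooth -/
  smooth : IsSmoothTorusAction n X
  /-- the action is effective -/
  effective : FaithfulSMul (Torus (n - 1)) X
  /-- the fixed point set is finite -/
  finite_fixed : (MulAction.fixedPoints (Torus (n - 1)) X).Finite
  /-- adjoining condition: the closure of every connected component of a fine partition element
  `X^H = {y | T_y = H}`, `H ≠ T`, contains a point with stabilizer of larger dimension -/
  adjoining : ∀ x : X, MulAction.stabilizer (Torus (n - 1)) x ≠ ⊤ →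
    ∃ x' ∈ closure (connectedComponentIn
        {y : X | MulAction.stabilizer (Torus (n - 1)) y = MulAction.stabilizer (Torus (n - 1)) x} x),
      torusDim (MulAction.stabilizer (Torus (n - 1)) x)
        < torusDim (MulAction.stabilizer (Torus (n - 1)) x')
  /-- strictness: every stabilizer (a closed subgroup) is connected, i.e. a torus -/
  strict : ∀ x : X, IsConnected (MulAction.stabilizer (Torus (n - 1)) x : Set (Torus (n - 1)))
  /-- general position: at every fixed point any `n - 1` of the `n` tangent weights are linearly
  independent -/
  general_position : ∀ x ∈ MulAction.fixedPoints (Torus (n - 1)) X,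
    ∃ α : Fin n → Fin (n - 1) → ℤ, IsTangentWeights x α ∧
      ∀ i : Fin n, LinearIndependent ℤ (fun j : {j : Fin n // j ≠ i} => α j)
  /-- the action is free on the boundary -/
  free_boundary : ∀ x ∈ (𝓡∂ (2 * n)).boundary X, MulAction.stabilizer (Torus (n - 1)) x = ⊥

end Actions

/-! ### Singular cohomology in degree two -/

section Cohomology

/-- Singular `k`-simplices of `B`. -/
abbrev SingSimplex (k : ℕ) (B : Type*) [TopologicalSpace B] : Type _ :=
  C(stdSimplex ℝ (Fin (k + 1)), B)

/-- The inclusion of the `i`-th face of the standard `(k+1)`-simplex. -/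
noncomputable def simplexFace (k : ℕ) (i : Fin (k + 2)) :
    C(stdSimplex ℝ (Fin (k + 1)), stdSimplex ℝ (Fin (k + 2))) :=
  ⟨stdSimplex.map i.succAbove, stdSimplex.continuous_map _⟩

variable (k : ℕ) (B : Type*) [TopologicalSpace B] (A : Type*) [AddCommGroup A]

/-- The coboundary `C^k(B; A) → C^{k+1}(B; A)` on singular cochains. -/
noncomputable def singCoboundary : (SingSimplex k B → A) →+ (SingSimplex (k + 1) B → A) where
  toFun c := fun σ => ∑ i : Fin (k + 2), (-1 : ℤ) ^ (i : ℕ) • c (σ.comp (simplexFace k i))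
  map_zero' := by funext σ; simp
  map_add' c d := by funext σ; simp [Finset.sum_add_distrib]

/-- Singular 2-cocycles. -/
noncomputable abbrev SingCocycle2 : AddSubgroup (SingSimplex 2 B → A) := (singCoboundary 2 B A).ker

/-- The second singular cohomology group `H^2(B; A)`. -/
abbrev SingH2 : Type _ := SingCocycle2 B A ⧸ (singCoboundary 1 B A).range.addSubgroupOf
  (SingCocycle2 B A)

variable {B A}
variable {B' : Type*} [TopologicalSpace B']

theorem singCoboundary_comp (f : C(B', B)) (c : SingSimplex k B → A) :
    singCoboundary k B' A (fun σ => c (f.comp σ)) =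
      fun σ => singCoboundary k B A c (f.comp σ) := rfl

/-- Pull-back of 2-cocycles along a continuous map. -/
noncomputable def pullCocycle2 (f : C(B', B)) : SingCocycle2 B A →+ SingCocycle2 B' A where
  toFun c := ⟨fun σ => c.1 (f.comp σ), by
    have hc := c.2
    rw [AddMonoidHom.mem_ker] at hc ⊢
    rw [singCoboundary_comp, hc]
    rfl⟩
  map_zero' := rfl
  map_add' _ _ := rfl

/-- The induced homomorphism `f^* : H^2(B; A) → H^2(B'; A)`. -/
noncomputable def pullH2 (f : C(B', B)) : SingH2 B A →+ SingH2 B' A :=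
  QuotientAddGroup.map _ _ (pullCocycle2 f) (by
    rintro c hc
    rw [AddSubgroup.mem_addSubgroupOf] at hc
    obtain ⟨b, hb⟩ := hc
    rw [AddSubgroup.mem_comap, AddSubgroup.mem_addSubgroupOf]
    refine ⟨fun σ => b (f.comp σ), ?_⟩
    rw [singCoboundary_comp, hb]
    rfl)

theorem pullH2_comp {B'' : Type*} [TopologicalSpace B''] (f : C(B', B)) (g : C(B'', B'))
    (a : SingH2 B A) : pullH2 g (pullH2 f a) = pullH2 (f.comp g) a := by
  induction a using QuotientAddGroup.induction_on with
  | H z => rfl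

/-- The homomorphism induced by an inclusion of subspaces. -/
noncomputable def resH2 {Q : Type*} [TopologicalSpace Q] {S R : Set Q} (h : R ⊆ S) :
    SingH2 S A →+ SingH2 R A :=
  pullH2 ⟨Set.inclusion h, continuous_inclusion h⟩

theorem resH2_comp {Q : Type*} [TopologicalSpace Q] {S R P : Set Q} (h : R ⊆ S) (h' : P ⊆ R)
    (a : SingH2 S A) : resH2 h' (resH2 h a) = resH2 (h'.trans h) a :=
  pullH2_comp _ _ a

/-! ### Local classes -/

variable {Q : Type*} [TopologicalSpace Q]

/-- Two classes on `U \ Z` and `V \ Z` agree near `x` if they have the same restriction to `W \ Z`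
for some neighborhood `W ⊆ U ∩ V` of `x`. -/
def localH2Setoid (A : Type*) [AddCommGroup A] (Z : Set Q) (x : Q) :
    Setoid (Σ U : {U : Set Q // IsOpen U ∧ x ∈ U}, SingH2 (U.1 \ Z : Set Q) A) where
  r a b := ∃ W : {U : Set Q // IsOpen U ∧ x ∈ U}, ∃ (ha : W.1 ⊆ a.1.1) (hb : W.1 ⊆ b.1.1),
    resH2 (Set.sdiff_subset_sdiff_left ha) a.2 = resH2 (Set.sdiff_subset_sdiff_left hb) b.2
  iseqv :=
    { refl := fun a => ⟨a.1, subset_rfl, subset_rfl, rfl⟩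
      symm := fun ⟨W, ha, hb, h⟩ => ⟨W, hb, ha, h.symm⟩
      trans := by
        rintro a b c ⟨W, ha, hb, h⟩ ⟨W', hb', hc, h'⟩
        refine ⟨⟨W.1 ∩ W'.1, W.2.1.inter W'.2.1, W.2.2, W'.2.2⟩,
          Set.inter_subset_left.trans ha, Set.inter_subset_right.trans hc, ?_⟩
        have e1 := congrArg (resH2 (Set.sdiff_subset_sdiff_left
          (Set.inter_subset_left : W.1 ∩ W'.1 ⊆ W.1))) h
        have e2 := congrArg (resH2 (Set.sdiff_subset_sdiff_left
          (Set.inter_subset_right : W.1 ∩ W'.1 ⊆ W'.1))) h'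
        rw [resH2_comp, resH2_comp] at e1 e2
        exact e1.trans e2 }

/-- The local group at `x`: the direct limit of `H^2(U \ Z; A)` over the open neighborhoods `U` of
`x`. When `Z` is conic near `x`, it is `H^2(U_x \ Z; A)` for a small disc neighborhood `U_x`. -/
def LocalH2 (A : Type*) [AddCommGroup A] (Z : Set Q) (x : Q) : Type _ :=
  Quotient (localH2Setoid A Z x)

/-- The local class `e_x` at `x` of a class `e ∈ H^2(Q \ Z; A)`: the image of `e` under restriction
to `U_x \ Z`, for small neighborhoods `U_x` of `x`. -/
noncomputable def localClass {Z : Set Q} (e : SingH2 (Zᶜ : Set Q) A) (x : Q) : LocalH2 A Z x :=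
  Quotient.mk (localH2Setoid A Z x)
    ⟨⟨Set.univ, isOpen_univ, Set.mem_univ x⟩, resH2 (fun _ h => h.2) e⟩

/-! ### The Euler class of a principal torus bundle -/

variable {m : ℕ} {X : Type*} [TopologicalSpace X] [MulAction (Torus m) X]

/-- `c` is an obstruction cochain of `p : X → Q` over `B ⊆ Q`, where `p` restricts over `B` to a
principal `T^m`-bundle: choose a lift `v b` of every point `b` of `B` and then a lift `ℓ σ` of every
singular 1-simplex `σ` of `B` with the chosen end points. For a singular 2-simplex `τ`, the lift
over its boundary formed by the lifts of its faces is compared with a lift `s` of `τ`; the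
difference is a loop `∂Δ² → T^m` and `c τ ∈ H_1(T^m) = ℤ^m` is its homotopy class. Here
`θ i` is a continuous logarithm of the difference along the `i`-th face. -/
def IsObstructionCochain (p : X → Q) (B : Set Q) (c : SingSimplex 2 B → (Fin m → ℤ)) : Prop :=
  ∃ (v : B → X) (ℓ : SingSimplex 1 B → C(stdSimplex ℝ (Fin 2), X)),
    (∀ b, p (v b) = b) ∧
    (∀ σ t, p (ℓ σ t) = σ t) ∧
    (∀ σ i, ℓ σ (stdSimplex.vertex i) = v (σ (stdSimplex.vertex i))) ∧
    ∀ τ : SingSimplex 2 B, ∃ (s : C(stdSimplex ℝ (Fin 3), X))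
      (θ : Fin 3 → C(stdSimplex ℝ (Fin 2), Fin m → ℝ)),
      (∀ t, p (s t) = τ t) ∧
      (∀ i t, ℓ (τ.comp (simplexFace 1 i)) t = torusExp (θ i t) • s (simplexFace 1 i t)) ∧
      ∀ j, 2 * Real.pi * (c τ j : ℝ) =
        ∑ i : Fin 3, (-1 : ℝ) ^ (i : ℕ) *
          (θ i (stdSimplex.vertex 1) j - θ i (stdSimplex.vertex 0) j)

/-- `e ∈ H^2(B; ℤ^m)` is the Euler class of the principal `T^m`-bundle `p⁻¹(B) → B`: the primary
obstruction to a section, which is the class of any obstruction cochain. -/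
def IsEulerClass (p : X → Q) (B : Set Q) (e : SingH2 B (Fin m → ℤ)) : Prop :=
  ∃ c : SingCocycle2 B (Fin m → ℤ), IsObstructionCochain p B c.1 ∧ QuotientAddGroup.mk c = e

end Cohomology

/-! ### Simple cell structures and the orbit space `M × D²` -/

section SpecialData

open Topology

/-- A regular simple cell structure on a closed `(n-1)`-manifold: a CW structure with cells of
dimension at most `n - 1` in which every characteristic map embeds the closed ball, and every
`k`-dimensional cell is contained in exactly `n - k` maximal cells. -/
structure IsSimpleCellStructure (n : ℕ) (M : Type*) [TopologicalSpace M]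
    [CWComplex (Set.univ : Set M)] : Prop where
  dim_lt : ∀ k, n ≤ k → IsEmpty (RelCWComplex.cell (Set.univ : Set M) k)
  regular : ∀ k (a : RelCWComplex.cell (Set.univ : Set M) k),
    Set.InjOn (RelCWComplex.map k a) (Metric.closedBall 0 1)
  simple : ∀ k, k < n → ∀ a : RelCWComplex.cell (Set.univ : Set M) k,
    Nat.card {b : RelCWComplex.cell (Set.univ : Set M) (n - 1) //
      RelCWComplex.closedCell k a ⊆ RelCWComplex.closedCell (n - 1) b} = n - k

/-- The closed disc `D²`. -/
abbrev Disc : Type := Metric.closedBall (0 : ℂ) 1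

/-- `Z_M ⊆ M × D²`: the `(n-2)`-skeleton of `M = M × {0}`. -/
def skeletonSponge (n : ℕ) (M : Type*) [TopologicalSpace M] [T2Space M]
    [CWComplex (Set.univ : Set M)] : Set (M × Disc) :=
  {q | q.1 ∈ RelCWComplex.skeletonLT (Set.univ : Set M) ((n - 1 : ℕ) : ℕ∞) ∧ (q.2 : ℂ) = 0}

/-- The projection `X → X/T ≅ Q` for an identification of the orbit space with `Q`. -/
noncomputable def orbitProj {m : ℕ} {X Q : Type*} [TopologicalSpace X] [MulAction (Torus m) X]
    [TopologicalSpace Q] (h : MulAction.orbitRel.Quotient (Torus m) X ≃ₜ Q) (x : X) : Q :=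
  h (Quotient.mk _ x)

/-- The action of `T^{n-1}` on `X` has characteristic data `(M × D², Z_M, μ, e)`, where the orbit
space (with its boundary `∂X/T`) is identified with `M × D²` by `h`. -/
structure HasCharacteristicData (n : ℕ) [NeZero n] {M : Type*} [TopologicalSpace M] [T2Space M]
    [CWComplex (Set.univ : Set M)] {X : Type*} [TopologicalSpace X]
    [ChartedSpace (EuclideanHalfSpace (2 * n)) X] [MulAction (Torus (n - 1)) X]
    (h : MulAction.orbitRel.Quotient (Torus (n - 1)) X ≃ₜ M × Disc)
    (μ : RelCWComplex.cell (Set.univ : Set M) (n - 2) → (Fin (n - 1) → ℤ))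
    (e : SingH2 ((skeletonSponge n M)ᶜ : Set (M × Disc)) (Fin (n - 1) → ℤ)) : Prop where
  /-- `∂X/T = M × ∂D²` -/
  boundary : ∀ x : X, x ∈ (𝓡∂ (2 * n)).boundary X ↔ ‖((orbitProj h x).2 : ℂ)‖ = 1
  /-- the orbits of dimension at most `n - 2` form `Z_M` -/
  sponge : ∀ x : X, 0 < torusDim (MulAction.stabilizer (Torus (n - 1)) x) ↔
    orbitProj h x ∈ skeletonSponge n M
  /-- `μ` sends a facet of `Z_M` to the oriented circle subgroup stabilizing its interior points -/
  characteristic_injective : ∀ a, Function.Injective (torusCocharacter (μ a))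
  characteristic_stabilizer : ∀ a (x : X),
    (orbitProj h x).1 ∈ RelCWComplex.openCell (n - 2) a → ((orbitProj h x).2 : ℂ) = 0 →
    MulAction.stabilizer (Torus (n - 1)) x = (torusCocharacter (μ a)).range
  /-- `e` is the Euler class of the free part of the action -/
  euler : IsEulerClass (orbitProj h) (skeletonSponge n M)ᶜ e

/-- The principal bundle `∂X → ∂X/T = M × ∂D²` is trivial. -/
def IsTrivialOverBoundary (n : ℕ) [NeZero n] {M : Type*} [TopologicalSpace M]
    {X : Type*} [TopologicalSpace X]
    [ChartedSpace (EuclideanHalfSpace (2 * n)) X] [MulAction (Torus (n - 1)) X]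
    (h : MulAction.orbitRel.Quotient (Torus (n - 1)) X ≃ₜ M × Disc) : Prop :=
  ∃ Φ : {q : M × Disc // ‖(q.2 : ℂ)‖ = 1} × Torus (n - 1) ≃ₜ (𝓡∂ (2 * n)).boundary X,
    (∀ b t, orbitProj h (Φ (b, t)) = b) ∧ ∀ b t u, (Φ (b, t * u) : X) = t • (Φ (b, u) : X)

end SpecialData

/-! Let `c` be the difference of cocycles representing the two Euler classes, and let `Z` be the
(n-2)-skeleton of `M`. Then `c` is a 2-cocycle on the complement of `Z × {0}` in `M × D²`. It is a
coboundary over `M × S¹`, because both bundles are trivial there, and near every point of `Z × {0}`,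
because the local classes agree. These two facts force `c` to be a coboundary, by a Mayer–Vietoris
argument carried out on singular cochains (`isCoboundaryOn_discComplement`).

The complement is the union of two open sets: `M` times the punctured disc, and the disjoint union
of the products `U_i × D²` over the open maximal cells `U_i`. The first retracts radially onto `M ×
S¹`, so `c` has a primitive `b₁` there; each `U_i × D²` is contractible, so `c` has a primitive
`b_i` there. On `U_i` times the punctured disc the 1-cocycle `b₁ - b_i` is determined up to
coboundary by its period around the fibre circle, and these periods are the only obstruction to
gluing.

The local hypothesis makes the periods agree across `Z`. Around any point of `M` there is a
primitive `b` of `c`, and the period of `b₁ - b` is constant on a connected neighborhood, since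
fibre circles of positive radius move freely across `Z`. Over a point outside `Z` a small fibre disc
lies in the complement, so the period is independent of `b`; such points are dense. The period is
therefore a well-defined locally constant function on all of `M` (`IsLocalPeriod`). Subtracting from
`b₁` the winding number weighted by this function kills every period
(`exists_primitive_without_periods`), and `b₁ - b_i` becomes exact (`IsCocycleOn.exists_primitive`).

The glued cochain is a primitive of `c` only on simplices inside one of the two open sets. The
remaining error vanishes on small simplices and is a coboundary by
`exists_coboundary_of_locally_zero`, whose proof integrates along subdivided segments instead of
using barycentric subdivision. -/

/-! ### Affine singular simplices in convex sets -/

section AffineSimplices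

variable {V : Type*} [AddCommGroup V] [Module ℝ V] [TopologicalSpace V] [IsTopologicalAddGroup V]
  [ContinuousSMul ℝ V] {K : Set V}

/-- The affine simplex with given vertices in a convex set. -/
noncomputable def affineSimplex (hK : Convex ℝ K) {k : ℕ} (p : Fin (k + 1) → K) :
    SingSimplex k K where
  toFun t := ⟨∑ i, t i • (p i : V),
    hK.sum_mem (fun i _ => t.2.1 i) t.2.2 (fun i _ => (p i).2)⟩
  continuous_toFun := by
    refine Continuous.subtype_mk (continuous_finsetSum _ fun i _ => ?_) _
    exact ((continuous_apply i).comp continuous_subtype_val).smul continuous_const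

theorem affineSimplex_apply (hK : Convex ℝ K) {k : ℕ} (p : Fin (k + 1) → K)
    (t : stdSimplex ℝ (Fin (k + 1))) :
    (affineSimplex hK p t : V) = ∑ i, t i • (p i : V) := rfl

theorem simplexFace_apply_self (k : ℕ) (i : Fin (k + 2)) (t : stdSimplex ℝ (Fin (k + 1))) :
    simplexFace k i t i = 0 := by
  change FunOnFinite.linearMap ℝ ℝ i.succAbove t i = 0
  rw [FunOnFinite.linearMap_apply_apply]
  refine Finset.sum_eq_zero fun j hj => ?_
  exact absurd (Finset.mem_filter.1 hj).2 (Fin.succAbove_ne i j)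

theorem simplexFace_apply_succAbove (k : ℕ) (i : Fin (k + 2)) (t : stdSimplex ℝ (Fin (k + 1)))
    (j : Fin (k + 1)) : simplexFace k i t (i.succAbove j) = t j := by
  change FunOnFinite.linearMap ℝ ℝ i.succAbove t (i.succAbove j) = t j
  rw [FunOnFinite.linearMap_apply_apply, Finset.sum_eq_single j]
  · intro l hl hlj
    exact absurd (Fin.succAbove_right_injective (Finset.mem_filter.1 hl).2) hlj
  · intro h
    simp at h

theorem affineSimplex_comp_face (hK : Convex ℝ K) {k : ℕ} (p : Fin (k + 2) → K)
    (i : Fin (k + 2)) :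
    (affineSimplex hK p).comp (simplexFace k i) = affineSimplex hK (p ∘ i.succAbove) := by
  ext t
  change ∑ j, simplexFace k i t j • (p j : V) = ∑ j, t j • (p (i.succAbove j) : V)
  rw [Fin.sum_univ_succAbove _ i, simplexFace_apply_self, zero_smul, zero_add]
  exact Finset.sum_congr rfl fun j _ => by rw [simplexFace_apply_succAbove]

/-- A map which is the restriction of an affine map carries affine simplices to affine
simplices. -/
theorem comp_affineSimplex {V' : Type*} [AddCommGroup V'] [Module ℝ V'] [TopologicalSpace V']
    [IsTopologicalAddGroup V'] [ContinuousSMul ℝ V'] {K' : Set V'} (hK : Convex ℝ K)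
    (hK' : Convex ℝ K') (f : C(K, K')) (L : V →ₗ[ℝ] V') (w : V')
    (hL : ∀ x : K, (f x : V') = L x + w) {k : ℕ} (p : Fin (k + 1) → K) :
    f.comp (affineSimplex hK p) = affineSimplex hK' (f ∘ p) := by
  refine ContinuousMap.ext fun t => Subtype.ext ?_
  change (f (affineSimplex hK p t) : V') = ∑ i, t i • (f (p i) : V')
  simp only [hL, affineSimplex_apply, map_sum, smul_add, Finset.sum_add_distrib, map_smul]
  rw [← Finset.sum_smul, stdSimplex.sum_eq_one, one_smul]

theorem affineSimplex_stdSimplex (k : ℕ) :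
    affineSimplex (convex_stdSimplex ℝ (Fin (k + 1))) (fun i => stdSimplex.vertex i)
      = ContinuousMap.id _ := by
  refine ContinuousMap.ext fun t => Subtype.ext ?_
  change (∑ i, t i • (Pi.single i (1 : ℝ) : Fin (k + 1) → ℝ)) = t.1
  funext j
  change _ = t j
  simp [Finset.sum_apply, Pi.single_apply]

theorem simplexFace_vertex (k : ℕ) (i : Fin (k + 2)) (j : Fin (k + 1)) :
    simplexFace k i (stdSimplex.vertex j) = stdSimplex.vertex (i.succAbove j) :=
  stdSimplex.map_vertex _ _

end AffineSimplices

/-! ### Cochains evaluated on affine edges and triangles -/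

section CochainsOnConvexSets

variable {E : Type*} [TopologicalSpace E] {A : Type*} [AddCommGroup A]

theorem singCoboundary_one_apply (b : SingSimplex 1 E → A) (τ : SingSimplex 2 E) :
    singCoboundary 1 E A b τ = b (τ.comp (simplexFace 1 0)) - b (τ.comp (simplexFace 1 1))
      + b (τ.comp (simplexFace 1 2)) := by
  simp [singCoboundary, Fin.sum_univ_three, sub_eq_add_neg]

theorem singCoboundary_two_apply (c : SingSimplex 2 E → A) (τ : SingSimplex 3 E) :
    singCoboundary 2 E A c τ = c (τ.comp (simplexFace 2 0)) - c (τ.comp (simplexFace 2 1))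
      + c (τ.comp (simplexFace 2 2)) - c (τ.comp (simplexFace 2 3)) := by
  simp [singCoboundary, Fin.sum_univ_four, sub_eq_add_neg, pow_succ]

/-- Cochains on `E` which are cocycles on the simplices inside `S`. -/
def IsCocycleOn (k : ℕ) (S : Set E) (c : SingSimplex k E → A) : Prop :=
  ∀ σ : SingSimplex (k + 1) E, (∀ t, σ t ∈ S) → singCoboundary k E A c σ = 0

/-- The 2-cochain `c` is a coboundary on the simplices inside `S`. -/
def IsCoboundaryOn (S : Set E) (c : SingSimplex 2 E → A) : Prop :=
  ∃ b : SingSimplex 1 E → A, ∀ τ : SingSimplex 2 E, (∀ t, τ t ∈ S) →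
    singCoboundary 1 E A b τ = c τ

variable {V : Type*} [AddCommGroup V] [Module ℝ V] [TopologicalSpace V] [IsTopologicalAddGroup V]
  [ContinuousSMul ℝ V] {K : Set V} (hK : Convex ℝ K) (G : C(K, E))

/-- The value of a 1-cochain on an affine edge. -/
noncomputable def edgeValue (z : SingSimplex 1 E → A) (p q : K) : A :=
  z (G.comp (affineSimplex hK ![p, q]))

/-- The value of a 2-cochain on an affine triangle. -/
noncomputable def triangleValue (c : SingSimplex 2 E → A) (p q r : K) : A :=
  c (G.comp (affineSimplex hK ![p, q, r]))

theorem comp_affine_triangle_face (p q r : K) (i : Fin 3) :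
    (G.comp (affineSimplex hK ![p, q, r])).comp (simplexFace 1 i)
      = G.comp (affineSimplex hK (![![q, r], ![p, r], ![p, q]] i)) := by
  rw [ContinuousMap.comp_assoc, affineSimplex_comp_face]
  congr 2
  funext j
  fin_cases i <;> fin_cases j <;> rfl

theorem comp_affine_tetrahedron_face (p q r s : K) (i : Fin 4) :
    (G.comp (affineSimplex hK ![p, q, r, s])).comp (simplexFace 2 i)
      = G.comp (affineSimplex hK (![![q, r, s], ![p, r, s], ![p, q, s], ![p, q, r]] i)) := by
  rw [ContinuousMap.comp_assoc, affineSimplex_comp_face]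
  congr 2
  funext j
  fin_cases i <;> fin_cases j <;> rfl

variable {S : Set E}

-- An affine map only moves the vertices of an affine edge. This and its analogue for triangles
-- identify values on faces of simplices, on walls and levels of prisms, and on translates of a
-- cylinder.
omit [AddCommGroup A] in
theorem edgeValue_comp {V' : Type*} [AddCommGroup V'] [Module ℝ V'] [TopologicalSpace V']
    [IsTopologicalAddGroup V'] [ContinuousSMul ℝ V'] {K' : Set V'} (hK' : Convex ℝ K')
    (G : C(K', E)) (f : C(K, K')) (L : V →ₗ[ℝ] V') (w : V')
    (hL : ∀ x : K, (f x : V') = L x + w) (z : SingSimplex 1 E → A) (p q : K) :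
    edgeValue hK (G.comp f) z p q = edgeValue hK' G z (f p) (f q) := by
  unfold edgeValue
  rw [ContinuousMap.comp_assoc, comp_affineSimplex hK hK' f L w hL]
  congr 3
  funext j
  fin_cases j <;> rfl

omit [AddCommGroup A] in
theorem triangleValue_comp {V' : Type*} [AddCommGroup V'] [Module ℝ V'] [TopologicalSpace V']
    [IsTopologicalAddGroup V'] [ContinuousSMul ℝ V'] {K' : Set V'} (hK' : Convex ℝ K')
    (G : C(K', E)) (f : C(K, K')) (L : V →ₗ[ℝ] V') (w : V')
    (hL : ∀ x : K, (f x : V') = L x + w) (c : SingSimplex 2 E → A) (p q r : K) :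
    triangleValue hK (G.comp f) c p q r = triangleValue hK' G c (f p) (f q) (f r) := by
  unfold triangleValue
  rw [ContinuousMap.comp_assoc, comp_affineSimplex hK hK' f L w hL]
  congr 3
  funext j
  fin_cases j <;> rfl

theorem edgeValue_add (hG : ∀ x, G x ∈ S) {z : SingSimplex 1 E → A} (hz : IsCocycleOn 1 S z) (p q r : K) :
    edgeValue hK G z p q + edgeValue hK G z q r = edgeValue hK G z p r := by
  have h := hz (G.comp (affineSimplex hK ![p, q, r])) (fun t => hG _)
  rw [singCoboundary_one_apply] at h
  simp only [comp_affine_triangle_face] at h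
  change edgeValue hK G z q r - edgeValue hK G z p r + edgeValue hK G z p q = 0 at h
  rw [← sub_eq_zero, ← h]
  abel

theorem triangleValue_cocycle (hG : ∀ x, G x ∈ S) {c : SingSimplex 2 E → A} (hc : IsCocycleOn 2 S c) (p q r s : K) :
    triangleValue hK G c q r s - triangleValue hK G c p r s + triangleValue hK G c p q s
      - triangleValue hK G c p q r = 0 := by
  have h := hc (G.comp (affineSimplex hK ![p, q, r, s])) (fun t => hG _)
  rw [singCoboundary_two_apply] at h
  simp only [comp_affine_tetrahedron_face] at h
  exact h

end CochainsOnConvexSets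

/-! ### Cocycles vanishing on small simplices -/

section LocallyZero

open Uniformity

variable {A : Type*} [AddCommGroup A]

/-- A function of two points of a bounded convex set which is additive near the diagonal is, near
the diagonal, the difference of the values of a function of one point. -/
theorem exists_primitive_of_additive_near_diagonal {V : Type*} [NormedAddCommGroup V]
    [NormedSpace ℝ V] {K : Set V} (hK : Convex ℝ K) (hb : Bornology.IsBounded K) (p₀ : K)
    {β : K → K → A} {δ : ℝ} (hδ : 0 < δ)
    (hβ : ∀ p q r : K, dist p q < δ → dist q r < δ → dist p r < δ → β p q + β q r = β p r) :
    ∃ f : K → A, ∀ᶠ x in 𝓤 K, β x.1 x.2 = f x.2 - f x.1 := by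
  obtain ⟨R, hR⟩ := Metric.isBounded_iff.1 hb
  obtain ⟨N, hN⟩ := exists_nat_gt (R / (δ / 2))
  have hR0 : 0 ≤ R := by simpa using hR p₀.2 p₀.2
  have hN0 : (0 : ℝ) < N := lt_of_le_of_lt (by positivity) hN
  -- The parameter is clamped at 1 so that the subdivision points stay in `K` for every natural `i`.
  -- The choice of `N` makes consecutive points closer than `δ / 2`.
  have hmem : ∀ (p : K) (i : ℕ), AffineMap.lineMap (p₀ : V) (p : V)
      (min ((i : ℝ) / N) 1) ∈ K := fun p i =>
    hK.lineMap_mem p₀.2 p.2 ⟨le_min (by positivity) zero_le_one, min_le_right _ _⟩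
  let x : K → ℕ → K := fun p i => ⟨_, hmem p i⟩
  have hx0 : ∀ p, x p 0 = p₀ := fun p => Subtype.ext (by simp [x])
  have hxN : ∀ p, x p N = p := fun p => Subtype.ext (by simp [x, hN0.ne'])
  have hstep : ∀ p i, dist (x p i) (x p (i + 1)) < δ / 2 := by
    intro p i
    change dist (AffineMap.lineMap (p₀ : V) (p : V) _) (AffineMap.lineMap (p₀ : V) (p : V) _) < _
    rw [dist_lineMap_lineMap]
    have h1 : dist (min ((i : ℝ) / N) 1) (min (((i + 1 : ℕ) : ℝ) / N) 1) ≤ 1 / N := by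
      have := abs_min_sub_min_le_max ((i : ℝ) / N) 1 (((i + 1 : ℕ) : ℝ) / N) 1
      rw [Real.dist_eq]
      refine this.trans (max_le ?_ (by simp))
      rw [← sub_div, abs_div, abs_of_pos hN0]
      simp
    calc _ ≤ 1 / N * R := mul_le_mul h1 (hR p₀.2 p.2) dist_nonneg (by positivity)
      _ = R / N := by ring
      _ < δ / 2 := by
        rw [div_lt_iff₀ (by positivity)] at hN ⊢
        linarith
  have hrung : ∀ p q i, dist (x p i) (x q i) ≤ dist p q := by
    intro p q i
    change dist (AffineMap.lineMap (p₀ : V) (p : V) _) (AffineMap.lineMap (p₀ : V) (q : V) _)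
      ≤ dist (p : V) q
    set t := min ((i : ℝ) / N) 1
    have ht0 : 0 ≤ t := le_min (by positivity) zero_le_one
    rw [dist_eq_norm, dist_eq_norm, AffineMap.lineMap_apply_module, AffineMap.lineMap_apply_module,
      add_sub_add_left_eq_sub, ← smul_sub, norm_smul, Real.norm_of_nonneg ht0]
    exact mul_le_of_le_one_left (norm_nonneg _) (min_le_right _ _)
  have hself : ∀ p, β p p = 0 := by
    intro p
    simpa using hβ p p p (by simpa) (by simpa) (by simpa)
  -- The primitive integrates `β` along the subdivided segment from `p₀` to `p`. For close `p` and
  -- `q` the two segments form a ladder whose rungs are no longer than `dist p q`; in each small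
  -- square additivity across the diagonal trades sides for rungs, and the rungs telescope.
  refine ⟨fun p => ∑ i ∈ Finset.range N, β (x p i) (x p (i + 1)), ?_⟩
  filter_upwards [Metric.dist_mem_uniformity (half_pos hδ)] with ⟨p, q⟩ hpq
  have hpq : dist p q < δ / 2 := hpq
  have hsq : ∀ i, β (x q i) (x q (i + 1)) - β (x p i) (x p (i + 1))
      = β (x p (i + 1)) (x q (i + 1)) - β (x p i) (x q i) := by
    intro i
    have r0 := (hrung p q i).trans_lt hpq
    have r1 := (hrung p q (i + 1)).trans_lt hpq
    have hd : dist (x p i) (x q (i + 1)) < δ := by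
      linarith [dist_triangle (x p i) (x q i) (x q (i + 1)), hstep q i]
    have e1 := hβ (x p i) (x p (i + 1)) (x q (i + 1)) (by linarith [hstep p i]) (by linarith) hd
    have e2 := hβ (x p i) (x q i) (x q (i + 1)) (by linarith) (by linarith [hstep q i]) hd
    rw [sub_eq_sub_iff_add_eq_add, add_comm (β (x q i) _), e2, ← e1, add_comm]
  change β p q = _ - _
  rw [← Finset.sum_sub_distrib, Finset.sum_congr rfl fun i _ => hsq i,
    Finset.sum_range_sub fun i => β (x p i) (x q i)]
  simp [hx0, hxN, hself]

omit [AddCommGroup A] in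
theorem eq_of_eventually_eq_uniformity {X : Type*} [UniformSpace X] [PreconnectedSpace X]
    {h : X → A} (hh : ∀ᶠ x in 𝓤 X, h x.1 = h x.2) (p q : X) : h p = h q := by
  refine IsLocallyConstant.apply_eq_of_preconnectedSpace
    ((IsLocallyConstant.iff_eventually_eq h).2 fun x => ?_) p q
  filter_upwards [mem_nhds_left x hh] with y hy
  exact Eq.symm hy

variable {E : Type*} [TopologicalSpace E]

/-- Below a Lebesgue number, `c` vanishes on triangles with close vertices; the cocycle relation on
the tetrahedron with apex `p₀` then says that coning from `p₀` gives a function of two points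
additive near the diagonal. -/
theorem exists_primitive_of_locally_zero {V : Type*} [NormedAddCommGroup V] [NormedSpace ℝ V]
    {K : Set V} (hK : Convex ℝ K) (hcpt : IsCompact K) (G : C(K, E)) {c : SingSimplex 2 E → A}
    (hc : IsCocycleOn 2 Set.univ c)
    (h0 : ∀ y : E, ∃ N : Set E, IsOpen N ∧ y ∈ N ∧ ∀ σ : SingSimplex 2 E, (∀ t, σ t ∈ N) → c σ = 0)
    (p₀ : K) :
    ∃ f : K → A, ∀ᶠ x in 𝓤 K, triangleValue hK G c p₀ x.1 x.2 = f x.2 - f x.1 := by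
  choose N hNo hyN hN using h0
  have := isCompact_iff_compactSpace.1 hcpt
  obtain ⟨δ, hδ, hball⟩ := lebesgue_number_lemma_of_metric (c := fun y => G ⁻¹' N y)
    (isCompact_univ (X := K)) (fun y => (hNo y).preimage G.continuous)
    (fun p _ => Set.mem_iUnion.2 ⟨G p, hyN _⟩)
  refine exists_primitive_of_additive_near_diagonal hK hcpt.isBounded p₀ hδ fun p q r h1 h2 h3 => ?_
  have hzero : triangleValue hK G c p q r = 0 := by
    obtain ⟨y, hy⟩ := hball p trivial
    refine hN y _ fun t => hy ?_
    change (affineSimplex hK ![p, q, r] t : V) ∈ Metric.ball (p : V) δ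
    rw [affineSimplex_apply]
    refine (convex_ball (p : V) δ).sum_mem (fun i _ => t.2.1 i) t.2.2 fun i _ => ?_
    fin_cases i
    · exact Metric.mem_ball_self hδ
    · exact (dist_comm _ _).trans_lt h1
    · exact (dist_comm _ _).trans_lt h3
  have := triangleValue_cocycle hK G (S := Set.univ) (fun _ => trivial) hc p₀ p q r
  rw [hzero] at this
  rw [← sub_eq_zero, ← neg_eq_zero, ← this]
  abel

omit [AddCommGroup A] in
theorem triangleValue_face (k : ℕ) (i : Fin (k + 2)) (τ : SingSimplex (k + 1) E)
    (c : SingSimplex 2 E → A) (p q r : stdSimplex ℝ (Fin (k + 1))) :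
    triangleValue (convex_stdSimplex ℝ _) (τ.comp (simplexFace k i)) c p q r
      = triangleValue (convex_stdSimplex ℝ _) τ c (simplexFace k i p) (simplexFace k i q)
        (simplexFace k i r) :=
  triangleValue_comp _ _ _ _ (FunOnFinite.linearMap ℝ ℝ i.succAbove) 0
    (fun _ => (add_zero _).symm) _ _ _ _

omit [AddCommGroup A] in
theorem triangleValue_vertex (τ : SingSimplex 2 E) (c : SingSimplex 2 E → A) :
    triangleValue (convex_stdSimplex ℝ _) τ c (stdSimplex.vertex 0) (stdSimplex.vertex 1)
      (stdSimplex.vertex 2) = c τ := by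
  unfold triangleValue
  have : (![stdSimplex.vertex 0, stdSimplex.vertex 1, stdSimplex.vertex 2] :
      Fin 3 → stdSimplex ℝ (Fin 3)) = fun i => stdSimplex.vertex i := by
    funext i
    fin_cases i <;> rfl
  rw [this, affineSimplex_stdSimplex, ContinuousMap.comp_id]

/-- A singular 2-cocycle which vanishes on all sufficiently small simplices is a coboundary. -/
theorem exists_coboundary_of_locally_zero {c : SingSimplex 2 E → A}
    (hc : IsCocycleOn 2 Set.univ c)
    (h0 : ∀ y : E, ∃ N : Set E, IsOpen N ∧ y ∈ N ∧
      ∀ σ : SingSimplex 2 E, (∀ t, σ t ∈ N) → c σ = 0) :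
    ∃ b : SingSimplex 1 E → A, singCoboundary 1 E A b = c := by
  have hex : ∀ (k : ℕ) (σ : SingSimplex k E), ∃ f : stdSimplex ℝ (Fin (k + 1)) → A,
      ∀ᶠ x in 𝓤 (stdSimplex ℝ (Fin (k + 1))),
        triangleValue (convex_stdSimplex ℝ _) σ c (stdSimplex.vertex 0) x.1 x.2 = f x.2 - f x.1 :=
    fun k σ => exists_primitive_of_locally_zero _ (isCompact_stdSimplex _ _) σ hc h0 _
  choose f hf using hex
  -- The cone value over the whole edge, corrected by the primitive `f` that computes it only near
  -- the diagonal.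
  let b : SingSimplex 1 E → A := fun γ =>
    triangleValue (convex_stdSimplex ℝ _) γ c (stdSimplex.vertex 0) (stdSimplex.vertex 0)
      (stdSimplex.vertex 1) - (f 1 γ (stdSimplex.vertex 1) - f 1 γ (stdSimplex.vertex 0))
  have hb : ∀ (τ : SingSimplex 2 E) (i : Fin 3), b (τ.comp (simplexFace 1 i))
      = triangleValue (convex_stdSimplex ℝ _) τ c (stdSimplex.vertex 0)
          (stdSimplex.vertex (i.succAbove 0)) (stdSimplex.vertex (i.succAbove 1))
        - (f 2 τ (stdSimplex.vertex (i.succAbove 1)) - f 2 τ (stdSimplex.vertex (i.succAbove 0))) := by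
    intro τ i
    set φ := simplexFace 1 i with hφ
    let g : stdSimplex ℝ (Fin 2) → A := fun p =>
      triangleValue (convex_stdSimplex ℝ _) τ c (stdSimplex.vertex 0) (φ (stdSimplex.vertex 0)) (φ p)
    -- Moving the cone apex from the first vertex of the face to vertex 0 of `τ` changes the cone
    -- function by a difference of values of `g`.
    have hβ : ∀ p q, triangleValue (convex_stdSimplex ℝ _) (τ.comp φ) c (stdSimplex.vertex 0) p q
        = triangleValue (convex_stdSimplex ℝ _) τ c (stdSimplex.vertex 0) (φ p) (φ q)
          - g q + g p := by
      intro p q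
      have := triangleValue_cocycle (convex_stdSimplex ℝ _) τ (S := Set.univ) (fun _ => trivial) hc
        (stdSimplex.vertex 0) (φ (stdSimplex.vertex 0)) (φ p) (φ q)
      rw [hφ, triangleValue_face, ← sub_eq_zero, ← this]
      simp only [g]
      abel
    have hφu : UniformContinuous φ := CompactSpace.uniformContinuous_of_continuous φ.continuous
    let d : stdSimplex ℝ (Fin 2) → A := fun p => f 1 (τ.comp φ) p - f 2 τ (φ p) + g p
    -- The primitives chosen independently for the face and for `τ` differ, after the apex
    -- correction, by a locally constant function on a connected simplex.
    have key : ∀ᶠ x in 𝓤 (stdSimplex ℝ (Fin 2)), d x.1 = d x.2 := by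
      filter_upwards [hf 1 (τ.comp φ), hφu.eventually (hf 2 τ)] with x h1 h2
      rw [hβ, h2] at h1
      rw [← sub_eq_zero] at h1 ⊢
      rw [← h1]
      simp only [d]
      abel
    have e := eq_of_eventually_eq_uniformity key (stdSimplex.vertex 0) (stdSimplex.vertex 1)
    simp only [b]
    rw [hβ, hφ, simplexFace_vertex, simplexFace_vertex]
    simp only [d, hφ, simplexFace_vertex] at e
    rw [← sub_eq_zero] at e ⊢
    rw [← e]
    abel
  refine ⟨b, funext fun τ => ?_⟩
  let v : Fin 3 → stdSimplex ℝ (Fin 3) := fun i => stdSimplex.vertex i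
  have e0 : b (τ.comp (simplexFace 1 0)) = triangleValue (convex_stdSimplex ℝ _) τ c (v 0) (v 1) (v 2)
    - (f 2 τ (v 2) - f 2 τ (v 1)) := hb τ 0
  have e1 : b (τ.comp (simplexFace 1 1)) = triangleValue (convex_stdSimplex ℝ _) τ c (v 0) (v 0) (v 2)
    - (f 2 τ (v 2) - f 2 τ (v 0)) := hb τ 1
  have e2 : b (τ.comp (simplexFace 1 2)) = triangleValue (convex_stdSimplex ℝ _) τ c (v 0) (v 0) (v 1)
    - (f 2 τ (v 1) - f 2 τ (v 0)) := hb τ 2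
  have h3 : triangleValue (convex_stdSimplex ℝ _) τ c (v 0) (v 1) (v 2) = c τ :=
    triangleValue_vertex τ c
  -- The values of `f` telescope around the boundary; this relation with a repeated vertex cancels
  -- the degenerate triangles, on which `c` need not vanish.
  have := triangleValue_cocycle (convex_stdSimplex ℝ _) τ (S := Set.univ) (fun _ => trivial) hc
    (v 0) (v 0) (v 1) (v 2)
  rw [singCoboundary_one_apply, e0, e1, e2, ← h3, ← sub_eq_zero, ← neg_eq_zero, ← this]
  abel

end LocallyZero

/-! ### Homotopy invariance by the prism operator -/

section HomotopyInvariance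

variable {A : Type*} [AddCommGroup A] {E : Type*} [TopologicalSpace E]

theorem convex_prism (k : ℕ) : Convex ℝ (stdSimplex ℝ (Fin (k + 1)) ×ˢ Set.Icc (0 : ℝ) 1) :=
  (convex_stdSimplex ℝ _).prod (convex_Icc 0 1)

/-- A point of the prism over the standard simplex. -/
def prismPoint {k : ℕ} (t : stdSimplex ℝ (Fin (k + 1))) (s : unitInterval) :
    (stdSimplex ℝ (Fin (k + 1)) ×ˢ Set.Icc (0 : ℝ) 1 : Set ((Fin (k + 1) → ℝ) × ℝ)) :=
  ⟨(t.1, s.1), t.2, s.2⟩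

/-- The trace of a singular simplex under a homotopy, defined on the prism over the simplex. -/
noncomputable def prismMap (H : C(E × unitInterval, E)) {k : ℕ} (σ : SingSimplex k E) :
    C((stdSimplex ℝ (Fin (k + 1)) ×ˢ Set.Icc (0 : ℝ) 1 : Set ((Fin (k + 1) → ℝ) × ℝ)), E) where
  toFun x := H (σ ⟨x.1.1, x.2.1⟩, ⟨x.1.2, x.2.2⟩)
  continuous_toFun := by fun_prop

omit [AddCommGroup A] in
theorem triangleValue_prismMap_face (H : C(E × unitInterval, E)) (c : SingSimplex 2 E → A) {k : ℕ}
    (i : Fin (k + 2)) (τ : SingSimplex (k + 1) E) (p q r : stdSimplex ℝ (Fin (k + 1)))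
    (x y z : unitInterval) :
    triangleValue (convex_prism k) (prismMap H (τ.comp (simplexFace k i))) c (prismPoint p x)
        (prismPoint q y) (prismPoint r z)
      = triangleValue (convex_prism (k + 1)) (prismMap H τ) c (prismPoint (simplexFace k i p) x)
        (prismPoint (simplexFace k i q) y) (prismPoint (simplexFace k i r) z) := by
  let F : C((stdSimplex ℝ (Fin (k + 1)) ×ˢ Set.Icc (0 : ℝ) 1 : Set ((Fin (k + 1) → ℝ) × ℝ)),
      (stdSimplex ℝ (Fin (k + 2)) ×ˢ Set.Icc (0 : ℝ) 1 : Set ((Fin (k + 2) → ℝ) × ℝ))) :=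
    ⟨fun x => prismPoint (simplexFace k i ⟨x.1.1, x.2.1⟩) ⟨x.1.2, x.2.2⟩, by
      unfold prismPoint
      fun_prop⟩
  exact triangleValue_comp (convex_prism k) (convex_prism (k + 1)) (prismMap H τ) F
    ((FunOnFinite.linearMap ℝ ℝ i.succAbove).prodMap LinearMap.id) 0
    (fun _ => (add_zero _).symm) c _ _ _

omit [AddCommGroup A] in
theorem triangleValue_prismMap_level (H : C(E × unitInterval, E)) (c : SingSimplex 2 E → A)
    (τ : SingSimplex 2 E) (s : unitInterval) :
    triangleValue (convex_prism 2) (prismMap H τ) c (prismPoint (stdSimplex.vertex 0) s)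
        (prismPoint (stdSimplex.vertex 1) s) (prismPoint (stdSimplex.vertex 2) s)
      = c ⟨fun t => H (τ t, s), by fun_prop⟩ := by
  let F : C(stdSimplex ℝ (Fin 3),
      (stdSimplex ℝ (Fin 3) ×ˢ Set.Icc (0 : ℝ) 1 : Set ((Fin 3 → ℝ) × ℝ))) :=
    ⟨fun x => prismPoint x s, by unfold prismPoint; fun_prop⟩
  have := triangleValue_comp (convex_stdSimplex ℝ _) (convex_prism 2) (prismMap H τ) F
    (LinearMap.inl ℝ _ ℝ) (0, s.1) (fun x => by simp [F, prismPoint]) c (stdSimplex.vertex 0)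
    (stdSimplex.vertex 1) (stdSimplex.vertex 2)
  rw [triangleValue_vertex] at this
  exact this.symm

/-- Homotopy invariance: a 2-cocycle on `E` is a coboundary when its pull-back along a map
homotopic to the identity is one. -/
theorem exists_coboundary_of_homotopy (H : C(E × unitInterval, E)) (h0 : ∀ x, H (x, 0) = x)
    {c : SingSimplex 2 E → A} (hc : IsCocycleOn 2 Set.univ c) (b : SingSimplex 1 E → A)
    (hb : ∀ τ : SingSimplex 2 E, singCoboundary 1 E A b τ = c ⟨fun t => H (τ t, 1), by fun_prop⟩) :
    ∃ b : SingSimplex 1 E → A, singCoboundary 1 E A b = c := by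
  let v : Fin 2 → unitInterval → (stdSimplex ℝ (Fin (1 + 1)) ×ˢ Set.Icc (0 : ℝ) 1 : Set _) :=
    fun i s => prismPoint (stdSimplex.vertex i) s
  let w : Fin 3 → unitInterval → (stdSimplex ℝ (Fin (2 + 1)) ×ˢ Set.Icc (0 : ℝ) 1 : Set _) :=
    fun i s => prismPoint (stdSimplex.vertex i) s
  -- The prism operator: the square swept out by an edge is cut into two triangles along its
  -- diagonal.
  let P : SingSimplex 1 E → A := fun γ =>
    triangleValue (convex_prism 1) (prismMap H γ) c (v 0 0) (v 0 1) (v 1 1)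
      - triangleValue (convex_prism 1) (prismMap H γ) c (v 0 0) (v 1 0) (v 1 1)
  have hP : ∀ (τ : SingSimplex 2 E) (i : Fin 3), P (τ.comp (simplexFace 1 i))
      = triangleValue (convex_prism 2) (prismMap H τ) c (w (i.succAbove 0) 0) (w (i.succAbove 0) 1)
          (w (i.succAbove 1) 1)
        - triangleValue (convex_prism 2) (prismMap H τ) c (w (i.succAbove 0) 0)
          (w (i.succAbove 1) 0) (w (i.succAbove 1) 1) := by
    intro τ i
    simp only [P, v, w, triangleValue_prismMap_face, simplexFace_vertex]
  refine ⟨fun γ => b γ - P γ, funext fun τ => ?_⟩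
  have e0 : P (τ.comp (simplexFace 1 0)) =
      triangleValue (convex_prism 2) (prismMap H τ) c (w 1 0) (w 1 1) (w 2 1)
      - triangleValue (convex_prism 2) (prismMap H τ) c (w 1 0) (w 2 0) (w 2 1) := hP τ 0
  have e1 : P (τ.comp (simplexFace 1 1)) =
      triangleValue (convex_prism 2) (prismMap H τ) c (w 0 0) (w 0 1) (w 2 1)
      - triangleValue (convex_prism 2) (prismMap H τ) c (w 0 0) (w 2 0) (w 2 1) := hP τ 1
  have e2 : P (τ.comp (simplexFace 1 2)) =
      triangleValue (convex_prism 2) (prismMap H τ) c (w 0 0) (w 0 1) (w 1 1)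
      - triangleValue (convex_prism 2) (prismMap H τ) c (w 0 0) (w 1 0) (w 1 1) := hP τ 2
  have hbot : triangleValue (convex_prism 2) (prismMap H τ) c (w 0 0) (w 1 0) (w 2 0) = c τ := by
    rw [triangleValue_prismMap_level]
    congr 1
    ext t
    exact h0 _
  have htop := triangleValue_prismMap_level H c τ 1
  rw [← hb τ] at htop
  change triangleValue (convex_prism 2) (prismMap H τ) c (w 0 1) (w 1 1) (w 2 1) = _ at htop
  have hcoc := triangleValue_cocycle (convex_prism 2) (prismMap H τ) (S := Set.univ)
    (fun _ => trivial) hc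
  -- The three tetrahedra of the triangular prism over `τ`.
  have f1 := hcoc (w 0 0) (w 0 1) (w 1 1) (w 2 1)
  have f2 := hcoc (w 0 0) (w 1 0) (w 1 1) (w 2 1)
  have f3 := hcoc (w 0 0) (w 1 0) (w 2 0) (w 2 1)
  rw [singCoboundary_one_apply] at htop ⊢
  rw [e0, e1, e2, ← hbot]
  linear_combination (norm := abel) f1 - f2 + f3 - htop

end HomotopyInvariance

/-! ### Cochains on a space with conditions on a subset -/

section RelativeCochains

variable {A : Type*} [AddCommGroup A] {E : Type*} [TopologicalSpace E]
  {B : Type*} [TopologicalSpace B]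

open Classical in
/-- Extension by zero of a cochain along a map of spaces. -/
noncomputable def extendCochain {k : ℕ} (j : C(B, E)) (b : SingSimplex k B → A) :
    SingSimplex k E → A :=
  fun σ => if h : ∃ σ₀ : SingSimplex k B, j.comp σ₀ = σ then b h.choose else 0

theorem extendCochain_comp {k : ℕ} {j : C(B, E)} (hj : Function.Injective j)
    (b : SingSimplex k B → A) (σ : SingSimplex k B) : extendCochain j b (j.comp σ) = b σ := by
  have h : ∃ σ₀ : SingSimplex k B, j.comp σ₀ = j.comp σ := ⟨σ, rfl⟩
  rw [extendCochain, dif_pos h]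
  congr 1
  exact ContinuousMap.ext fun t => hj (DFunLike.congr_fun h.choose_spec t)

theorem singCoboundary_extendCochain {k : ℕ} {j : C(B, E)} (hj : Function.Injective j)
    (b : SingSimplex k B → A) (τ : SingSimplex (k + 1) B) :
    singCoboundary k E A (extendCochain j b) (j.comp τ) = singCoboundary k B A b τ := by
  change ∑ i : Fin (k + 2), (-1 : ℤ) ^ (i : ℕ) • extendCochain j b (j.comp (τ.comp (simplexFace k i)))
    = ∑ i : Fin (k + 2), (-1 : ℤ) ^ (i : ℕ) • b (τ.comp (simplexFace k i))
  exact Finset.sum_congr rfl fun i _ => by rw [extendCochain_comp hj]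

theorem exists_lift_of_isEmbedding {k : ℕ} {j : C(B, E)} (hj : Topology.IsEmbedding j)
    (σ : SingSimplex k E) (h : ∀ t, σ t ∈ Set.range j) : ∃ σ₀ : SingSimplex k B, j.comp σ₀ = σ := by
  choose f hf using h
  exact ⟨⟨f, hj.continuous_iff.2 (by convert! σ.continuous using 1; exact funext hf)⟩,
    ContinuousMap.ext hf⟩

/-- The inclusion of a subspace. -/
def inclusionMap (S : Set E) : C(S, E) := ⟨Subtype.val, continuous_subtype_val⟩

theorem IsCocycleOn.comp {k : ℕ} {S : Set E} {c : SingSimplex k E → A} (hc : IsCocycleOn k S c)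
    (j : C(B, E)) (hj : ∀ x, j x ∈ S) : IsCocycleOn k Set.univ (fun σ => c (j.comp σ)) :=
  fun σ _ => hc (j.comp σ) fun _ => hj _

theorem IsCocycleOn.mono {k : ℕ} {S T : Set E} (hTS : T ⊆ S) {c : SingSimplex k E → A}
    (hc : IsCocycleOn k S c) : IsCocycleOn k T c :=
  fun σ h => hc σ fun t => hTS (h t)

theorem IsCoboundaryOn.mono {S T : Set E} (hTS : T ⊆ S) {c : SingSimplex 2 E → A}
    (hc : IsCoboundaryOn S c) : IsCoboundaryOn T c :=
  let ⟨b, hb⟩ := hc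
  ⟨b, fun τ h => hb τ fun t => hTS (h t)⟩

theorem isCoboundaryOn_range {j : C(B, E)} (hj : Topology.IsEmbedding j) {c : SingSimplex 2 E → A}
    {b : SingSimplex 1 B → A} (hb : ∀ τ, singCoboundary 1 B A b τ = c (j.comp τ)) :
    IsCoboundaryOn (Set.range j) c := by
  refine ⟨extendCochain j b, fun τ h => ?_⟩
  obtain ⟨τ₀, rfl⟩ := exists_lift_of_isEmbedding hj τ h
  rw [singCoboundary_extendCochain hj.injective, hb]

theorem isCoboundaryOn_of_subtype {S : Set E} {c : SingSimplex 2 E → A} {b : SingSimplex 1 S → A}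
    (hb : ∀ τ, singCoboundary 1 S A b τ = c ((inclusionMap S).comp τ)) : IsCoboundaryOn S c :=
  (isCoboundaryOn_range (j := inclusionMap S) Topology.IsEmbedding.subtypeVal hb).mono
    (by simp [inclusionMap])

theorem isCoboundaryOn_of_locally_zero {S : Set E} {c : SingSimplex 2 E → A}
    (hc : IsCocycleOn 2 S c)
    (h0 : ∀ y ∈ S, ∃ N : Set E, IsOpen N ∧ y ∈ N ∧
      ∀ σ : SingSimplex 2 E, (∀ t, σ t ∈ N ∩ S) → c σ = 0) : IsCoboundaryOn S c := by
  obtain ⟨b, hb⟩ := exists_coboundary_of_locally_zero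
    (hc.comp (inclusionMap S) fun x => x.2) (fun y => by
      obtain ⟨N, hN, hy, h⟩ := h0 y y.2
      exact ⟨Subtype.val ⁻¹' N, hN.preimage continuous_subtype_val, hy,
        fun σ hσ => h _ fun t => ⟨hσ t, (σ t).2⟩⟩)
  exact isCoboundaryOn_of_subtype fun τ => congrFun hb τ

/-- The end of the deformation maps `S` into `T`, so a primitive on `T` pulls back along it to `S`;
the prism operator corrects the difference. -/
theorem isCoboundaryOn_of_homotopy {S T : Set E} {c : SingSimplex 2 E → A}
    (hc : IsCocycleOn 2 S c) (H : C(S × unitInterval, S)) (h0 : ∀ x, H (x, 0) = x)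
    (h1 : ∀ x, (H (x, 1) : E) ∈ T) (hT : IsCoboundaryOn T c) : IsCoboundaryOn S c := by
  obtain ⟨b, hb⟩ := hT
  let r : C(S, E) := ⟨fun x => H (x, 1), by fun_prop⟩
  obtain ⟨b', hb'⟩ := exists_coboundary_of_homotopy H h0
    (hc.comp (inclusionMap S) fun x => x.2) (fun γ => b (r.comp γ))
    (fun τ => hb (r.comp τ) fun t => h1 _)
  exact isCoboundaryOn_of_subtype fun τ => congrFun hb' τ

theorem isCoboundaryOn_singleton (x : E) (c : SingSimplex 2 E → A) : IsCoboundaryOn {x} c := by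
  -- A triangle has three faces with signs +, -, +, so the coboundary of a constant cochain is that
  -- constant.
  refine ⟨fun _ => c (ContinuousMap.const _ x), fun τ h => ?_⟩
  rw [singCoboundary_one_apply, sub_self, zero_add]
  exact congrArg c (ContinuousMap.ext fun t => (h t).symm)

end RelativeCochains

/-! ### Winding numbers of paths in the circle -/

section Winding

open Real

instance (k : ℕ) : SimplyConnectedSpace (stdSimplex ℝ (Fin (k + 1))) :=
  have := (convex_stdSimplex ℝ (Fin (k + 1))).contractibleSpace
    ⟨_, single_mem_stdSimplex ℝ (0 : Fin (k + 1))⟩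
  inferInstance

instance (k : ℕ) : LocallyPathConnectedSpace (stdSimplex ℝ (Fin (k + 1))) :=
  (convex_stdSimplex ℝ (Fin (k + 1))).locallyPathConnectedSpace

theorem exists_circle_lift {k : ℕ} (u : SingSimplex k Circle) :
    ∃ θ : SingSimplex k ℝ, ∀ t, Circle.exp (θ t) = u t := by
  obtain ⟨F, ⟨-, hF⟩, -⟩ := Circle.isCoveringMap_exp.existsUnique_continuousMap_lifts u
    (stdSimplex.vertex 0) (Complex.arg (u (stdSimplex.vertex 0))) (Circle.exp_arg _)
  exact ⟨F, fun t => congrFun hF t⟩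

/-- Shifted to agree at `y`, the two logarithms coincide by uniqueness of lifts along the
exponential covering. -/
theorem circle_lift_sub {k : ℕ} {θ θ' : SingSimplex k ℝ}
    (h : ∀ t, Circle.exp (θ t) = Circle.exp (θ' t)) (x y : stdSimplex ℝ (Fin (k + 1))) :
    θ x - θ y = θ' x - θ' y := by
  have e := Circle.isCoveringMap_exp.eq_of_comp_eq (A := stdSimplex ℝ (Fin (k + 1)))
    (g₁ := fun t => θ t) (g₂ := fun t => θ' t + (θ y - θ' y)) (by fun_prop) (by fun_prop)
    (funext fun t => by simp [Circle.exp_add, Circle.exp_sub, h]) y (by ring)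
  have := congrFun e x
  linarith

/-- The winding number of a path in the circle, closed up through the principal branch of the
argument. -/
theorem exists_windingCochain : ∃ W : SingSimplex 1 Circle → ℤ, ∀ (u : SingSimplex 1 Circle)
    (θ : SingSimplex 1 ℝ), (∀ t, Circle.exp (θ t) = u t) →
    2 * π * (W u : ℝ) = θ (stdSimplex.vertex 1) - θ (stdSimplex.vertex 0)
      - Complex.arg (u (stdSimplex.vertex 1)) + Complex.arg (u (stdSimplex.vertex 0)) := by
  have : ∀ u : SingSimplex 1 Circle, ∃ w : ℤ, ∀ θ : SingSimplex 1 ℝ,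
      (∀ t, Circle.exp (θ t) = u t) →
      2 * π * (w : ℝ) = θ (stdSimplex.vertex 1) - θ (stdSimplex.vertex 0)
        - Complex.arg (u (stdSimplex.vertex 1)) + Complex.arg (u (stdSimplex.vertex 0)) := by
    intro u
    obtain ⟨θ, hθ⟩ := exists_circle_lift u
    have h : ∀ t, ∃ m : ℤ, θ t = Complex.arg (u t) + m * (2 * π) := fun t =>
      Circle.exp_eq_exp.1 (by rw [hθ, Circle.exp_arg])
    obtain ⟨m₀, h₀⟩ := h (stdSimplex.vertex 0)
    obtain ⟨m₁, h₁⟩ := h (stdSimplex.vertex 1)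
    refine ⟨m₁ - m₀, fun θ' hθ' => ?_⟩
    rw [circle_lift_sub (fun t => (hθ' t).trans (hθ t).symm), h₀, h₁]
    push_cast
    ring
  choose W hW using this
  exact ⟨W, hW⟩

/-- The winding cochain on the circle. -/
noncomputable def windingCochain : SingSimplex 1 Circle → ℤ := exists_windingCochain.choose

theorem windingCochain_spec (u : SingSimplex 1 Circle) (θ : SingSimplex 1 ℝ)
    (h : ∀ t, Circle.exp (θ t) = u t) :
    2 * π * (windingCochain u : ℝ) = θ (stdSimplex.vertex 1) - θ (stdSimplex.vertex 0)
      - Complex.arg (u (stdSimplex.vertex 1)) + Complex.arg (u (stdSimplex.vertex 0)) :=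
  exists_windingCochain.choose_spec u θ h

theorem windingCochain_cocycle : IsCocycleOn 1 Set.univ windingCochain := by
  intro τ _
  obtain ⟨θ, hθ⟩ := exists_circle_lift τ
  have h : ∀ i : Fin 3, 2 * π * (windingCochain (τ.comp (simplexFace 1 i)) : ℝ)
      = θ (stdSimplex.vertex (i.succAbove 1)) - θ (stdSimplex.vertex (i.succAbove 0))
      - Complex.arg (τ (stdSimplex.vertex (i.succAbove 1)))
      + Complex.arg (τ (stdSimplex.vertex (i.succAbove 0))) := by
    intro i
    rw [windingCochain_spec (τ.comp (simplexFace 1 i)) (θ.comp (simplexFace 1 i)) (fun t => hθ _)]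
    simp only [ContinuousMap.comp_apply, simplexFace_vertex]
  rw [singCoboundary_one_apply]
  let v : Fin 3 → stdSimplex ℝ (Fin 3) := fun i => stdSimplex.vertex i
  have h0 : _ = θ (v 2) - θ (v 1) - Complex.arg (τ (v 2)) + Complex.arg (τ (v 1)) := h 0
  have h1 : _ = θ (v 2) - θ (v 0) - Complex.arg (τ (v 2)) + Complex.arg (τ (v 0)) := h 1
  have h2 : _ = θ (v 1) - θ (v 0) - Complex.arg (τ (v 1)) + Complex.arg (τ (v 0)) := h 2
  have : 2 * π * ((windingCochain (τ.comp (simplexFace 1 0))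
      - windingCochain (τ.comp (simplexFace 1 1))
      + windingCochain (τ.comp (simplexFace 1 2)) : ℤ) : ℝ) = 0 := by
    push_cast
    linear_combination h0 - h1 + h2
  exact_mod_cast (mul_eq_zero.1 this).resolve_left (by positivity)

end Winding

/-! ### Obstruction cochains of trivialized bundles -/

section EulerClass

open Real

variable {m : ℕ} {X Q : Type*} [TopologicalSpace X] [TopologicalSpace Q] [MulAction (Torus m) X]

/-- Over a set where the bundle has an equivariant fibre coordinate, an obstruction cochain is a
coboundary. -/
theorem IsObstructionCochain.exists_coboundary {p : X → Q} {B D : Set Q}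
    {c : SingSimplex 2 B → (Fin m → ℤ)} (hc : IsObstructionCochain p B c) (ψ : X → Torus m)
    (hψ : ContinuousOn ψ (p ⁻¹' D))
    (hequiv : ∀ (t : Torus m) (x : X), p x ∈ D → ψ (t • x) = t * ψ x) :
    ∃ β : SingSimplex 1 B → (Fin m → ℤ), ∀ τ : SingSimplex 2 B, (∀ t, (τ t : Q) ∈ D) →
      singCoboundary 1 B (Fin m → ℤ) β τ = c τ := by
  classical
  obtain ⟨v, ℓ, hv, hℓ, hℓv, h⟩ := hc
  have hcomp : ∀ {k : ℕ} (s : C(stdSimplex ℝ (Fin (k + 1)), X)), (∀ t, p (s t) ∈ D) →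
      ∀ j, Continuous fun t => ψ (s t) j := fun s hs j =>
    (continuous_apply j).comp (hψ.comp_continuous s.continuous hs)
  -- The winding of the chosen lift of `σ`, read in the fibre coordinate `ψ`.
  let β : SingSimplex 1 B → (Fin m → ℤ) := fun σ j =>
    if hσ : ∀ t, p (ℓ σ t) ∈ D then windingCochain ⟨_, hcomp (ℓ σ) hσ j⟩ else 0
  refine ⟨β, fun τ hτ => ?_⟩
  obtain ⟨s, θ, hs, hθ, hsum⟩ := h τ
  have hsD : ∀ t, p (s t) ∈ D := fun t => by rw [hs]; exact hτ t
  funext j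
  obtain ⟨lam, hlam⟩ := exists_circle_lift ⟨_, hcomp s hsD j⟩
  -- By equivariance, `θ i` plus the logarithm `lam` of `ψ ∘ s` is a logarithm along the `i`-th
  -- face. In the alternating sum the `lam` and `arg` terms cancel, leaving the sum that defines `c
  -- τ`.
  have hface : ∀ i : Fin 3, 2 * π * (β (τ.comp (simplexFace 1 i)) j : ℝ)
      = θ i (stdSimplex.vertex 1) j - θ i (stdSimplex.vertex 0) j
        + lam (stdSimplex.vertex (i.succAbove 1)) - lam (stdSimplex.vertex (i.succAbove 0))
        - Complex.arg (ψ (v (τ (stdSimplex.vertex (i.succAbove 1)))) j)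
        + Complex.arg (ψ (v (τ (stdSimplex.vertex (i.succAbove 0)))) j) := by
    intro i
    have hD : ∀ t, p (ℓ (τ.comp (simplexFace 1 i)) t) ∈ D := fun t => by
      rw [hℓ]; exact hτ _
    simp only [β]
    rw [dif_pos hD, windingCochain_spec _
      ⟨fun t => θ i t j + lam (simplexFace 1 i t), by fun_prop⟩ (fun t => ?_)]
    · simp only [ContinuousMap.coe_mk, hℓv, ContinuousMap.comp_apply, simplexFace_vertex]
      ring
    · change Circle.exp (_ + _) = ψ (ℓ (τ.comp (simplexFace 1 i)) t) j
      rw [hθ, hequiv _ _ (hsD _), Circle.exp_add, hlam]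
      rfl
  let w : Fin 3 → stdSimplex ℝ (Fin 3) := fun i => stdSimplex.vertex i
  have h0 : _ = _ + lam (w 2) - lam (w 1) - Complex.arg (ψ (v (τ (w 2))) j)
    + Complex.arg (ψ (v (τ (w 1))) j) := hface 0
  have h1 : _ = _ + lam (w 2) - lam (w 0) - Complex.arg (ψ (v (τ (w 2))) j)
    + Complex.arg (ψ (v (τ (w 0))) j) := hface 1
  have h2 : _ = _ + lam (w 1) - lam (w 0) - Complex.arg (ψ (v (τ (w 1))) j)
    + Complex.arg (ψ (v (τ (w 0))) j) := hface 2
  have h3 := hsum j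
  simp only [Fin.sum_univ_three, Fin.val_zero, Fin.val_one, Fin.val_two, pow_zero, pow_one, one_mul,
    neg_mul, neg_one_sq] at h3
  rw [singCoboundary_one_apply]
  have : 2 * π * ((β (τ.comp (simplexFace 1 0)) j - β (τ.comp (simplexFace 1 1)) j
      + β (τ.comp (simplexFace 1 2)) j - c τ j : ℤ) : ℝ) = 0 := by
    push_cast
    linear_combination h0 - h1 + h2 - h3
  have h4 : β (τ.comp (simplexFace 1 0)) j - β (τ.comp (simplexFace 1 1)) j
      + β (τ.comp (simplexFace 1 2)) j - c τ j = 0 := by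
    exact_mod_cast (mul_eq_zero.1 this).resolve_left (by positivity)
  exact sub_eq_zero.1 h4

end EulerClass

/-! ### Periods and primitives of 1-cocycles -/

section OneCocycles

open Real

variable {A : Type*} [AddCommGroup A] {E : Type*} [TopologicalSpace E]

theorem continuous_stdSimplex_apply {k : ℕ} (i : Fin (k + 1)) :
    Continuous fun t : stdSimplex ℝ (Fin (k + 1)) => t.1 i :=
  (continuous_apply i).comp continuous_subtype_val

theorem continuous_direction {Y : Type*} [TopologicalSpace Y] {w : Y → ℂ} (hw : Continuous w)
    (h0 : ∀ y, w y ≠ 0) : Continuous fun y => Circle.exp (w y).arg := by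
  have : (fun y => ((Circle.exp (w y).arg : Circle) : ℂ)) = fun y => w y / ‖w y‖ := by
    funext y
    rw [eq_div_iff (by simpa using h0 y), mul_comm]
    simp
  refine continuous_induced_rng.2 (?_ : Continuous fun y => ((Circle.exp (w y).arg : Circle) : ℂ))
  rw [this]
  exact hw.div (by fun_prop) fun y => by simpa using h0 y

omit [AddCommGroup A] in
theorem edgeValue_vertex (γ : SingSimplex 1 E) (z : SingSimplex 1 E → A) :
    edgeValue (convex_stdSimplex ℝ _) γ z (stdSimplex.vertex 0) (stdSimplex.vertex 1) = z γ := by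
  unfold edgeValue
  have : (![stdSimplex.vertex 0, stdSimplex.vertex 1] :
      Fin 2 → stdSimplex ℝ (Fin 2)) = fun i => stdSimplex.vertex i := by
    funext i
    fin_cases i <;> rfl
  rw [this, affineSimplex_stdSimplex, ContinuousMap.comp_id]

theorem IsCocycleOn.const_eq_zero {S : Set E} {z : SingSimplex 1 E → A} (hz : IsCocycleOn 1 S z)
    {x : E} (hx : x ∈ S) : z (ContinuousMap.const _ x) = 0 := by
  have := hz (ContinuousMap.const _ x) fun _ => hx
  rw [singCoboundary_one_apply, sub_eq_add_neg, add_right_comm] at this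
  simpa using this

variable {V : Type*} [NormedAddCommGroup V] [NormedSpace ℝ V] {K : Set V}

omit [AddCommGroup A] in
theorem edgeValue_eq_of_affine_path (hK : Convex ℝ K) (G : C(K, E)) (z : SingSimplex 1 E → A)
    (f : SingSimplex 1 K) (L : (Fin 2 → ℝ) →ₗ[ℝ] V) (w : V) (hf : ∀ t, (f t : V) = L t.1 + w) :
    edgeValue hK G z (f (stdSimplex.vertex 0)) (f (stdSimplex.vertex 1)) = z (G.comp f) := by
  rw [← edgeValue_comp (convex_stdSimplex ℝ _) hK G f L w hf, edgeValue_vertex]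

/-- A cocycle takes the same value on all paths of a convex set with given end points. -/
theorem IsCocycleOn.apply_comp_eq_edgeValue {S : Set E} {z : SingSimplex 1 E → A}
    (hz : IsCocycleOn 1 S z) (hK : Convex ℝ K) (G : C(K, E)) (hG : ∀ x, G x ∈ S)
    (γ : SingSimplex 1 K) :
    z (G.comp γ) = edgeValue hK G z (γ (stdSimplex.vertex 0)) (γ (stdSimplex.vertex 1)) := by
  set p := γ (stdSimplex.vertex 0)
  -- The straight-line contraction of `γ` to its initial point `p`. On the square, the bottom edge
  -- is `γ`, the top edge is constant, and the sides are affine edges ending at `p`.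
  let F : C((stdSimplex ℝ (Fin (1 + 1)) ×ˢ Set.Icc (0 : ℝ) 1 : Set ((Fin (1 + 1) → ℝ) × ℝ)), K) :=
    ⟨fun x => ⟨(1 - x.1.2) • (γ ⟨x.1.1, x.2.1⟩ : V) + x.1.2 • (p : V),
      hK (Subtype.coe_prop _) p.2 (sub_nonneg.2 x.2.2.2) x.2.2.1 (by ring)⟩, by fun_prop⟩
  let v : Fin 2 → unitInterval → (stdSimplex ℝ (Fin (1 + 1)) ×ˢ Set.Icc (0 : ℝ) 1 : Set _) :=
    fun i s => prismPoint (stdSimplex.vertex i) s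
  have hadd := edgeValue_add (convex_prism 1) (G.comp F) (fun _ => hG _) hz
  have hlevel : ∀ s : unitInterval, edgeValue (convex_prism 1) (G.comp F) z (v 0 s) (v 1 s)
      = z ((G.comp F).comp ⟨fun t => prismPoint t s, by unfold prismPoint; fun_prop⟩) := fun s =>
    edgeValue_eq_of_affine_path (convex_prism 1) (G.comp F) z
      ⟨fun t => prismPoint t s, by unfold prismPoint; fun_prop⟩ (LinearMap.inl ℝ _ ℝ) (0, s.1)
      (fun x => by simp [prismPoint])
  have hbot : edgeValue (convex_prism 1) (G.comp F) z (v 0 0) (v 1 0) = z (G.comp γ) := by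
    rw [hlevel]
    congr 1
    ext t
    simp [F, prismPoint]
  have htop : edgeValue (convex_prism 1) (G.comp F) z (v 0 1) (v 1 1) = 0 := by
    rw [hlevel, ← hz.const_eq_zero (hG p)]
    congr 1
    ext t
    simp [F, prismPoint]
  have hvert : ∀ i, edgeValue (convex_prism 1) (G.comp F) z (v i 0) (v i 1)
      = edgeValue hK G z (γ (stdSimplex.vertex i)) p := by
    intro i
    let f : SingSimplex 1 (stdSimplex ℝ (Fin (1 + 1)) ×ˢ Set.Icc (0 : ℝ) 1 : Set _) :=
      ⟨fun t => prismPoint (stdSimplex.vertex i) ⟨t.1 1, t.2.1 1, stdSimplex.le_one t 1⟩, by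
        have := continuous_stdSimplex_apply (1 : Fin (1 + 1))
        unfold prismPoint
        exact Continuous.subtype_mk (continuous_const.prodMk this) _⟩
    have e1 := edgeValue_eq_of_affine_path (convex_prism 1) (G.comp F) z f
      ((LinearMap.inr ℝ _ ℝ).comp (LinearMap.proj 1)) ((stdSimplex.vertex i).1, 0)
      (fun t => by simp [f, prismPoint])
    have e2 := edgeValue_eq_of_affine_path hK G z (F.comp f)
      ((LinearMap.proj 1).smulRight ((p : V) - γ (stdSimplex.vertex i)))
      (γ (stdSimplex.vertex i)) (fun t => by
        simp only [F, f, prismPoint, ContinuousMap.comp_apply, ContinuousMap.coe_mk,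
          LinearMap.smulRight_apply, LinearMap.proj_apply]
        module)
    have g0 : f (stdSimplex.vertex 0) = v i 0 := by
      simp [f, v, prismPoint]
    have g1 : f (stdSimplex.vertex 1) = v i 1 := by
      simp [f, v, prismPoint]
    have k0 : F (v i 0) = γ (stdSimplex.vertex i) := by
      simp [F, v, prismPoint]
    have k1 : F (v i 1) = p := by
      simp [F, v, prismPoint]
    rw [g0, g1] at e1
    rw [ContinuousMap.comp_apply, ContinuousMap.comp_apply, g0, g1, k0, k1] at e2
    rw [e1, e2]
    rfl
  have h1 := hadd (v 0 0) (v 1 0) (v 1 1)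
  have h2 := hadd (v 0 0) (v 0 1) (v 1 1)
  have h3 := edgeValue_add hK G hG hz p (γ (stdSimplex.vertex 1)) p
  rw [hbot, hvert] at h1
  rw [hvert, htop] at h2
  linear_combination (norm := abel) h1 - h2 - h3

/-- A point of a cylinder. -/
def cylinderPoint {K₀ : Set V} (x : K₀) (θ : ℝ) : (K₀ ×ˢ Set.univ : Set (V × ℝ)) :=
  ⟨(x, θ), x.2, trivial⟩

theorem convex_cylinder {K₀ : Set V} (hK : Convex ℝ K₀) :
    Convex ℝ (K₀ ×ˢ Set.univ : Set (V × ℝ)) := hK.prod convex_univ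

/-- Translation by `2π` preserves `G`, so opposite sides of the parallelogram joining the two
vertical edges have equal values, and hence so do the vertical edges. -/
theorem edgeValue_period {K₀ : Set V} (hK : Convex ℝ K₀)
    (G : C((K₀ ×ˢ Set.univ : Set (V × ℝ)), E)) {S : Set E} (hG : ∀ x, G x ∈ S)
    (hper : ∀ x θ, G (cylinderPoint x (θ + 2 * π)) = G (cylinderPoint x θ))
    {z : SingSimplex 1 E → A} (hz : IsCocycleOn 1 S z) (x y : K₀) (θ θ' : ℝ) :
    edgeValue (convex_cylinder hK) G z (cylinderPoint x θ) (cylinderPoint x (θ + 2 * π))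
      = edgeValue (convex_cylinder hK) G z (cylinderPoint y θ')
        (cylinderPoint y (θ' + 2 * π)) := by
  let T : C((K₀ ×ˢ Set.univ : Set (V × ℝ)), (K₀ ×ˢ Set.univ : Set (V × ℝ))) :=
    ⟨fun p => cylinderPoint ⟨p.1.1, p.2.1⟩ (p.1.2 + 2 * π), by unfold cylinderPoint; fun_prop⟩
  have hT : G.comp T = G := ContinuousMap.ext fun p => hper ⟨p.1.1, p.2.1⟩ p.1.2
  have hinv := edgeValue_comp (convex_cylinder hK) (convex_cylinder hK) G T LinearMap.id
    (0, 2 * π) (fun p => by simp [T, cylinderPoint, Prod.ext_iff]) z (cylinderPoint x θ) (cylinderPoint y θ')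
  rw [hT] at hinv
  have hinv : _ = edgeValue (convex_cylinder hK) G z (cylinderPoint x (θ + 2 * π))
    (cylinderPoint y (θ' + 2 * π)) := hinv
  have hadd := edgeValue_add (convex_cylinder hK) G hG hz
  have h1 := hadd (cylinderPoint x θ) (cylinderPoint y θ') (cylinderPoint y (θ' + 2 * π))
  have h2 := hadd (cylinderPoint x θ) (cylinderPoint x (θ + 2 * π)) (cylinderPoint y (θ' + 2 * π))
  linear_combination (norm := abel) h2 - h1 + hinv

variable {M : Type*} [TopologicalSpace M]

/-- The circle of radius `r` in the fibre over `y`. -/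
noncomputable def fibreLoop (y : M) (r : ℝ) : SingSimplex 1 (M × ℂ) where
  toFun t := (y, r * (Circle.exp (2 * π * t.1 1) : ℂ))
  continuous_toFun := by
    have h := (continuous_stdSimplex_apply (1 : Fin (1 + 1))).const_mul (2 * π)
    exact continuous_const.prodMk (continuous_const.mul
      ((by fun_prop : Continuous fun θ : ℝ => (Circle.exp θ : ℂ)).comp h))

omit [AddCommGroup A] in
theorem edgeValue_fibreLoop {K₀ : Set V} (hK : Convex ℝ K₀)
    (G : C((K₀ ×ˢ Set.univ : Set (V × ℝ)), M × ℂ)) (z : SingSimplex 1 (M × ℂ) → A) (x : K₀)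
    {y : M} {r : ℝ} (hG : ∀ θ, G (cylinderPoint x θ) = (y, r * (Circle.exp θ : ℂ))) :
    edgeValue (convex_cylinder hK) G z (cylinderPoint x 0) (cylinderPoint x (0 + 2 * π))
      = z (fibreLoop y r) := by
  let f : SingSimplex 1 (K₀ ×ˢ Set.univ : Set (V × ℝ)) :=
    ⟨fun t => cylinderPoint x (2 * π * t.1 1), by
      have h := (continuous_stdSimplex_apply (1 : Fin (1 + 1))).const_mul (2 * π)
      exact Continuous.subtype_mk (continuous_const.prodMk h) _⟩
  have := edgeValue_eq_of_affine_path (convex_cylinder hK) G z f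
    ((LinearMap.inr ℝ V ℝ).comp ((2 * π) • LinearMap.proj 1)) (x, 0)
    (fun t => by simp [f, cylinderPoint])
  have h0 : f (stdSimplex.vertex 0) = cylinderPoint x 0 :=
    congrArg (cylinderPoint x) (by simp)
  have h1 : f (stdSimplex.vertex 1) = cylinderPoint x (0 + 2 * π) :=
    congrArg (cylinderPoint x) (by simp)
  rw [h0, h1] at this
  rw [this]
  congr 1
  exact ContinuousMap.ext fun t => hG _

/-- The period of a cocycle does not change when the fibre circle moves inside `S`. -/
theorem IsCocycleOn.fibreLoop_eq {S : Set (M × ℂ)} {z : SingSimplex 1 (M × ℂ) → A}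
    (hz : IsCocycleOn 1 S z) {y y' : M} (η : Path y y') (r r' : ℝ)
    (h : ∀ (s : unitInterval) (θ : ℝ),
      (η s, ((AffineMap.lineMap r r' (s : ℝ) : ℝ) : ℂ) * (Circle.exp θ : ℂ)) ∈ S) :
    z (fibreLoop y r) = z (fibreLoop y' r') := by
  let G : C((Set.Icc (0 : ℝ) 1 ×ˢ Set.univ : Set (ℝ × ℝ)), M × ℂ) :=
    ⟨fun p => (η ⟨p.1.1, p.2.1⟩,
      ((AffineMap.lineMap r r' (p.1.1 : ℝ) : ℝ) : ℂ) * (Circle.exp p.1.2 : ℂ)), by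
        simp only [AffineMap.lineMap_apply_module]
        fun_prop⟩
  have hper : ∀ (x : Set.Icc (0 : ℝ) 1) θ, G (cylinderPoint x (θ + 2 * π)) = G (cylinderPoint x θ) := by
    intro x θ
    change (_, _ * ((Circle.exp (θ + 2 * π) : Circle) : ℂ)) = _
    rw [Circle.periodic_exp]
    rfl
  have e := edgeValue_period (convex_Icc 0 1) G (fun p => h ⟨p.1.1, p.2.1⟩ p.1.2) hper hz
    ⟨0, by simp⟩ ⟨1, by simp⟩ 0 0
  rwa [edgeValue_fibreLoop (convex_Icc 0 1) G z ⟨0, by simp⟩ (y := y) (r := r) (fun θ => ?_),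
    edgeValue_fibreLoop (convex_Icc 0 1) G z ⟨1, by simp⟩ (y := y') (r := r') (fun θ => ?_)] at e
  · refine Prod.ext η.target ?_
    simp [G, cylinderPoint]
  · refine Prod.ext η.source ?_
    simp [G, cylinderPoint]

theorem fibreLoop_zero (y : M) : fibreLoop y 0 = ContinuousMap.const _ (y, 0) :=
  ContinuousMap.ext fun t => by simp [fibreLoop]

/-- A cocycle on a cell times a punctured disc without periods is a coboundary. -/
theorem IsCocycleOn.exists_primitive (e : PartialEquiv V M) (hconv : Convex ℝ e.source)
    (hcont : ContinuousOn e e.source) (hcont' : ContinuousOn e.symm e.target)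
    {z : SingSimplex 1 (M × ℂ) → A}
    (hz : IsCocycleOn 1 {q : M × ℂ | q.1 ∈ e.target ∧ q.2 ≠ 0 ∧ ‖q.2‖ ≤ 1} z)
    (hper : ∀ y ∈ e.target, z (fibreLoop y 1) = 0) :
    ∃ g : M × ℂ → A, ∀ γ : SingSimplex 1 (M × ℂ),
      (∀ t, (γ t).1 ∈ e.target ∧ (γ t).2 ≠ 0 ∧ ‖(γ t).2‖ ≤ 1) →
      z γ = g (γ (stdSimplex.vertex 1)) - g (γ (stdSimplex.vertex 0)) := by
  classical
  by_cases hne : e.source.Nonempty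
  swap
  · refine ⟨0, fun γ h => absurd ⟨_, e.map_target (h (stdSimplex.vertex 0)).1⟩ hne⟩
  obtain ⟨u₀, hu₀⟩ := hne
  -- Cell coordinate and radius; together with an angle in `ℝ` they give polar coordinates on a
  -- convex covering space of the cell times the punctured disc.
  let K₀ : Set (V × ℝ) := e.source ×ˢ Set.Ioc (0 : ℝ) 1
  have hK₀ : Convex ℝ K₀ := hconv.prod (convex_Ioc 0 1)
  let S : Set (M × ℂ) := {q : M × ℂ | q.1 ∈ e.target ∧ q.2 ≠ 0 ∧ ‖q.2‖ ≤ 1}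
  let G : C((K₀ ×ˢ Set.univ : Set ((V × ℝ) × ℝ)), M × ℂ) :=
    ⟨fun p => (e p.1.1.1, (p.1.1.2 : ℂ) * (Circle.exp p.1.2 : ℂ)), by
      refine (hcont.comp_continuous (by fun_prop) fun p => p.2.1.1).prodMk (by fun_prop)⟩
  have hG : ∀ p, G p ∈ S := by
    intro p
    have h0 : 0 < p.1.1.2 := p.2.1.2.1
    refine ⟨e.map_source p.2.1.1, ?_, ?_⟩
    · simp [G, h0.ne']
    · simpa [G, abs_of_pos h0] using p.2.1.2.2
  let p₀ : (K₀ ×ˢ Set.univ : Set ((V × ℝ) × ℝ)) :=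
    cylinderPoint ⟨(u₀, 1), hu₀, by norm_num⟩ 0
  let f : (K₀ ×ˢ Set.univ : Set ((V × ℝ) × ℝ)) → A := fun p =>
    edgeValue (convex_cylinder hK₀) G z p₀ p
  have hf : ∀ p q, edgeValue (convex_cylinder hK₀) G z p q = f q - f p := fun p q => by
    rw [eq_sub_iff_add_eq, add_comm]
    exact edgeValue_add (convex_cylinder hK₀) G hG hz p₀ p q
  have hper' : ∀ (x : K₀) θ, G (cylinderPoint x (θ + 2 * π)) = G (cylinderPoint x θ) := by
    intro x θ
    change (_, _ * ((Circle.exp (θ + 2 * π) : Circle) : ℂ)) = _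
    rw [Circle.periodic_exp]
    rfl
  -- The increment of `f` over one turn is the period over the unit circle above `e u₀`, which
  -- vanishes. So `f` descends from the covering and may be evaluated at the principal argument.
  have hperiodic : ∀ x : K₀, Function.Periodic (fun θ => f (cylinderPoint x θ)) (2 * π) := by
    intro x θ
    change f (cylinderPoint x (θ + 2 * π)) = f (cylinderPoint x θ)
    rw [← sub_eq_zero, ← hf, edgeValue_period hK₀ G hG hper' hz x ⟨(u₀, 1), hu₀, by norm_num⟩ θ 0,
      edgeValue_fibreLoop hK₀ G z ⟨(u₀, 1), hu₀, by norm_num⟩ (y := e u₀) (r := 1) fun θ => ?_]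
    · exact hper _ (e.map_source hu₀)
    · simp [G, cylinderPoint]
  have hmem : ∀ q ∈ S, (e.symm q.1, ‖q.2‖) ∈ K₀ := fun q hq =>
    ⟨e.map_target hq.1, norm_pos_iff.2 hq.2.1, hq.2.2⟩
  refine ⟨fun q => if h : q ∈ S then f (cylinderPoint ⟨_, hmem q h⟩ q.2.arg) else 0,
    fun γ hγ => ?_⟩
  obtain ⟨θ, hθ⟩ := exists_circle_lift (k := 1) ⟨fun t => Circle.exp (γ t).2.arg,
    continuous_direction (by fun_prop) fun t => (hγ t).2.1⟩
  let γ' : SingSimplex 1 (K₀ ×ˢ Set.univ : Set ((V × ℝ) × ℝ)) :=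
    ⟨fun t => cylinderPoint ⟨_, hmem _ (hγ t)⟩ (θ t), by
      unfold cylinderPoint
      refine Continuous.subtype_mk (Continuous.prodMk (Continuous.prodMk ?_ ?_) ?_) _
      · exact hcont'.comp_continuous (by fun_prop) fun t => (hγ t).1
      · fun_prop
      · fun_prop⟩
  have hlift : G.comp γ' = γ := by
    refine ContinuousMap.ext fun t => Prod.ext (e.right_inv (hγ t).1) ?_
    change (‖(γ t).2‖ : ℂ) * (Circle.exp (θ t) : ℂ) = (γ t).2
    rw [hθ]
    simp
  have hval : ∀ t, f (γ' t) = f (cylinderPoint ⟨_, hmem _ (hγ t)⟩ (γ t).2.arg) := by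
    intro t
    obtain ⟨m, hm⟩ := Circle.exp_eq_exp.1 (hθ t)
    change f (cylinderPoint _ (θ t)) = _
    rw [hm]
    exact (hperiodic ⟨_, hmem _ (hγ t)⟩).int_mul m _
  have h := hz.apply_comp_eq_edgeValue (convex_cylinder hK₀) G hG γ'
  rw [hlift, hf, hval, hval] at h
  rw [h]
  simp only
  rw [dif_pos (show γ _ ∈ S from hγ _), dif_pos (show γ _ ∈ S from hγ _)]

end OneCocycles

/-! ### Punctured discs, cells, and weighted winding -/

section DiscBundle

open Real

variable {A : Type*} [AddCommGroup A] {M : Type*} [TopologicalSpace M]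

theorem singCoboundary_singCoboundary {E : Type*} [TopologicalSpace E] (b : SingSimplex 1 E → A) :
    singCoboundary 2 E A (singCoboundary 1 E A b) = 0 := by
  funext σ
  have hσ : σ = σ.comp (affineSimplex (convex_stdSimplex ℝ (Fin 4))
      ![stdSimplex.vertex 0, stdSimplex.vertex 1, stdSimplex.vertex 2, stdSimplex.vertex 3]) := by
    have : (![stdSimplex.vertex 0, stdSimplex.vertex 1, stdSimplex.vertex 2, stdSimplex.vertex 3] :
        Fin 4 → stdSimplex ℝ (Fin 4)) = fun i => stdSimplex.vertex i := by
      funext i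
      fin_cases i <;> rfl
    rw [this, affineSimplex_stdSimplex]
    rfl
  rw [hσ, singCoboundary_two_apply]
  simp only [comp_affine_tetrahedron_face, singCoboundary_one_apply, Matrix.cons_val,
    comp_affine_triangle_face, Pi.zero_apply]
  abel

theorem isCocycleOn_sub {E : Type*} [TopologicalSpace E] {S : Set E} {c : SingSimplex 2 E → A}
    {b b' : SingSimplex 1 E → A}
    (hb : ∀ τ : SingSimplex 2 E, (∀ t, τ t ∈ S) → singCoboundary 1 E A b τ = c τ)
    (hb' : ∀ τ : SingSimplex 2 E, (∀ t, τ t ∈ S) → singCoboundary 1 E A b' τ = c τ) :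
    IsCocycleOn 1 S (b - b') := fun τ h => by
  rw [map_sub, Pi.sub_apply, hb τ h, hb' τ h, sub_self]

/-- The product of the punctured unit disc with `M`. -/
def puncturedDiscs (M : Type*) : Set (M × ℂ) := {q | q.2 ≠ 0 ∧ ‖q.2‖ ≤ 1}

theorem isCoboundaryOn_puncturedDiscs {c : SingSimplex 2 (M × ℂ) → A}
    (hc : IsCocycleOn 2 (puncturedDiscs M) c) (h1 : IsCoboundaryOn {q : M × ℂ | ‖q.2‖ = 1} c) :
    IsCoboundaryOn (puncturedDiscs M) c := by
  have hnorm : ∀ (w : ℂ) (s : ℝ), w ≠ 0 → 0 ≤ s → s ≤ 1 →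
      ‖(((1 - s + s / ‖w‖ : ℝ) : ℂ)) * w‖ = (1 - s) * ‖w‖ + s := by
    intro w s hw h0 h1
    have : 0 < ‖w‖ := norm_pos_iff.2 hw
    rw [norm_mul, Complex.norm_real, Real.norm_of_nonneg
      (add_nonneg (sub_nonneg.2 h1) (by positivity))]
    field_simp
  -- Radial retraction onto the unit circle: the scaling factor runs affinely from 1 to `1 / ‖w‖`,
  -- so the norm runs affinely from `‖w‖` to 1.
  let H : C(puncturedDiscs M × unitInterval, puncturedDiscs M) :=
    ⟨fun p => ⟨(p.1.1.1, ((1 - (p.2 : ℝ) + (p.2 : ℝ) / ‖p.1.1.2‖ : ℝ) : ℂ) * p.1.1.2), by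
      have hw : 0 < ‖p.1.1.2‖ := norm_pos_iff.2 p.1.2.1
      have e := hnorm _ _ p.1.2.1 p.2.2.1 p.2.2.2
      have h0 := p.2.2.1
      have h1 := p.2.2.2
      refine ⟨norm_pos_iff.1 ?_, ?_⟩
      · rw [e]
        rcases h0.eq_or_lt with h | h
        · rw [← h]; simpa using p.1.2.1
        · have := mul_nonneg (sub_nonneg.2 h1) hw.le
          linarith
      · rw [e]
        have := mul_le_mul_of_nonneg_left p.1.2.2 (sub_nonneg.2 h1)
        linarith⟩, by
      refine Continuous.subtype_mk (Continuous.prodMk (by fun_prop) (Continuous.mul ?_ (by fun_prop))) _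
      refine Complex.continuous_ofReal.comp (Continuous.add (by fun_prop) (Continuous.div (by fun_prop)
        (by fun_prop) fun p => norm_ne_zero_iff.2 p.1.2.1))⟩
  refine isCoboundaryOn_of_homotopy hc H (fun x => ?_) (fun x => ?_) h1
  · refine Subtype.ext (Prod.ext rfl ?_)
    simp [H]
  · change ‖(((1 - (1 : ℝ) + (1 : ℝ) / ‖x.1.2‖ : ℝ) : ℂ)) * x.1.2‖ = 1
    rw [hnorm _ _ x.2.1 zero_le_one le_rfl]
    simp

variable {V : Type*} [NormedAddCommGroup V] [NormedSpace ℝ V]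

theorem isCoboundaryOn_cell (e : PartialEquiv V M) (hconv : Convex ℝ e.source)
    (hcont : ContinuousOn e e.source) (hcont' : ContinuousOn e.symm e.target)
    {c : SingSimplex 2 (M × ℂ) → A}
    (hc : IsCocycleOn 2 {q : M × ℂ | q.1 ∈ e.target ∧ ‖q.2‖ ≤ 1} c) :
    IsCoboundaryOn {q : M × ℂ | q.1 ∈ e.target ∧ ‖q.2‖ ≤ 1} c := by
  by_cases hne : e.source.Nonempty
  swap
  · exact ⟨0, fun τ h => absurd ⟨_, e.map_target (h (stdSimplex.vertex 0)).1⟩ hne⟩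
  obtain ⟨u₀, hu₀⟩ := hne
  let S : Set (M × ℂ) := {q : M × ℂ | q.1 ∈ e.target ∧ ‖q.2‖ ≤ 1}
  have hmem : ∀ p : S × unitInterval,
      (1 - (p.2 : ℝ)) • e.symm p.1.1.1 + (p.2 : ℝ) • u₀ ∈ e.source := fun p =>
    hconv (e.map_target p.1.2.1) hu₀ (sub_nonneg.2 p.2.2.2) p.2.2.1 (by ring)
  -- Contraction to `(e u₀, 0)`: straight lines in the cell coordinate, scaling to the center in the
  -- disc.
  let H : C(S × unitInterval, S) :=
    ⟨fun p => ⟨(e ((1 - (p.2 : ℝ)) • e.symm p.1.1.1 + (p.2 : ℝ) • u₀),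
        ((1 - (p.2 : ℝ) : ℝ) : ℂ) * p.1.1.2), e.map_source (hmem p), by
        change ‖((1 - (p.2 : ℝ) : ℝ) : ℂ) * p.1.1.2‖ ≤ 1
        rw [norm_mul, Complex.norm_real, Real.norm_of_nonneg (sub_nonneg.2 p.2.2.2)]
        exact mul_le_one₀ (by linarith [p.2.2.1]) (norm_nonneg _) p.1.2.2⟩, by
      refine Continuous.subtype_mk (Continuous.prodMk ?_ (by fun_prop)) _
      refine hcont.comp_continuous (Continuous.add (Continuous.smul (by fun_prop) ?_) (by fun_prop)) hmem
      exact hcont'.comp_continuous (by fun_prop) fun p => p.1.2.1⟩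
  refine isCoboundaryOn_of_homotopy (T := {(e u₀, 0)}) hc H (fun x => ?_) (fun x => ?_)
    (isCoboundaryOn_singleton _ _)
  · refine Subtype.ext (Prod.ext ?_ ?_)
    · simpa [H] using e.right_inv x.2.1
    · simp [H]
  · simp [H]

/-- The winding number around the zero section, weighted by a locally constant function. -/
theorem exists_weighted_winding {α : M → A} (hα : IsLocallyConstant α) :
    ∃ κ : SingSimplex 1 (M × ℂ) → A, IsCocycleOn 1 (puncturedDiscs M) κ ∧
      ∀ y r, 0 < r → r ≤ 1 → κ (fibreLoop y r) = α y := by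
  classical
  let κ : SingSimplex 1 (M × ℂ) → A := fun γ =>
    if h : ∀ t, (γ t).2 ≠ 0 then
      windingCochain ⟨fun t => Circle.exp (γ t).2.arg, continuous_direction (by fun_prop) h⟩
        • α (γ (stdSimplex.vertex 0)).1
    else 0
  refine ⟨κ, fun τ hτ => ?_, fun y r h0 h1 => ?_⟩
  · have hτ0 : ∀ t, (τ t).2 ≠ 0 := fun t => (hτ t).1
    let u : SingSimplex 2 Circle :=
      ⟨fun t => Circle.exp (τ t).2.arg, continuous_direction (by fun_prop) hτ0⟩
    have hκ : ∀ i : Fin 3, κ (τ.comp (simplexFace 1 i))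
        = windingCochain (u.comp (simplexFace 1 i)) • α (τ (stdSimplex.vertex 0)).1 := by
      intro i
      have h : ∀ t, ((τ.comp (simplexFace 1 i)) t).2 ≠ 0 := fun t => hτ0 _
      simp only [κ]
      rw [dif_pos h]
      congr 1
      -- The weight is constant along `τ`, so evaluating it at the first vertex of each face gives
      -- the same coefficient.
      exact (hα.comp_continuous (f := fun t => (τ t).1) (by fun_prop)).apply_eq_of_preconnectedSpace
        _ _
    have hw := windingCochain_cocycle u fun _ => trivial
    rw [singCoboundary_one_apply] at hw ⊢
    rw [hκ, hκ, hκ, ← sub_smul, ← add_smul, hw, zero_smul]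
  · have hne : ∀ t, (fibreLoop y r t).2 ≠ 0 := fun t => by
      simp [fibreLoop, h0.ne']
    have hexp : ∀ θ : ℝ, Circle.exp ((r : ℂ) * (Circle.exp θ : ℂ)).arg = Circle.exp θ := by
      intro θ
      rw [Complex.arg_real_mul _ h0, Circle.exp_arg]
    have hcoord := (continuous_stdSimplex_apply (1 : Fin (1 + 1))).const_mul (2 * π)
    have hw := windingCochain_spec
      ⟨fun t => Circle.exp (fibreLoop y r t).2.arg, continuous_direction (by fun_prop) hne⟩
      ⟨fun t => 2 * π * t.1 1, hcoord⟩ (fun t => (hexp _).symm)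
    simp only [κ]
    rw [dif_pos hne]
    have hw1 : windingCochain ⟨fun t => Circle.exp (fibreLoop y r t).2.arg,
        continuous_direction (by fun_prop) hne⟩ = 1 := by
      have : (2 * π) * ((windingCochain ⟨fun t => Circle.exp (fibreLoop y r t).2.arg,
        continuous_direction (by fun_prop) hne⟩ : ℤ) : ℝ) = 2 * π * 1 := by
        rw [hw]
        simp [fibreLoop]
      exact_mod_cast mul_left_cancel₀ (by positivity) this
    rw [hw1, one_smul]
    rfl

end DiscBundle

/-! ### Gluing primitives over the complement of the skeleton -/

section Core

open Real Topology

variable {A : Type*} [AddCommGroup A] {M : Type*} [TopologicalSpace M]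

/-- The complement of `Z × {0}` in `M × D²`. -/
def discComplement (Z : Set M) : Set (M × ℂ) := {q | ‖q.2‖ ≤ 1 ∧ (q.2 = 0 → q.1 ∉ Z)}

omit [TopologicalSpace M] in
theorem puncturedDiscs_subset (Z : Set M) : puncturedDiscs M ⊆ discComplement Z :=
  fun _ h => ⟨h.2, fun h0 => absurd h0 h.1⟩

/-- `a` is the period near `x` of `b₁` relative to a primitive of `c` near `x`. -/
def IsLocalPeriod (Z : Set M) (c : SingSimplex 2 (M × ℂ) → A) (b₁ : SingSimplex 1 (M × ℂ) → A)
    (x : M) (a : A) : Prop :=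
  ∃ (V : Set M) (ε : ℝ) (b : SingSimplex 1 (M × ℂ) → A), IsOpen V ∧ x ∈ V ∧ 0 < ε ∧ ε ≤ 1 ∧
    (∀ τ : SingSimplex 2 (M × ℂ), (∀ t, (τ t).1 ∈ V ∧ ‖(τ t).2‖ ≤ ε ∧ ((τ t).2 = 0 → (τ t).1 ∉ Z)) →
      singCoboundary 1 (M × ℂ) A b τ = c τ) ∧
    ∀ y ∈ V, ∀ r, 0 < r → r ≤ ε → (b₁ - b) (fibreLoop y r) = a

variable {Z : Set M} {c : SingSimplex 2 (M × ℂ) → A} {b₁ : SingSimplex 1 (M × ℂ) → A}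

theorem norm_ofReal_mul_circle {r : ℝ} (hr : 0 ≤ r) (z : Circle) : ‖(r : ℂ) * (z : ℂ)‖ = r := by
  rw [norm_mul, Circle.norm_coe, mul_one, Complex.norm_real, Real.norm_of_nonneg hr]

/-- Over a path-connected neighborhood all small fibre circles are homotopic in the punctured discs,
even across `Z`, and both `b₁` and the local primitive are primitives of `c` there. -/
theorem exists_isLocalPeriod [LocallyPathConnectedSpace M]
    (hb₁ : ∀ τ : SingSimplex 2 (M × ℂ), (∀ t, τ t ∈ puncturedDiscs M) →
      singCoboundary 1 (M × ℂ) A b₁ τ = c τ) {x : M} {W : Set (M × ℂ)} (hW : IsOpen W)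
    (hx : (x, 0) ∈ W) (hc : IsCoboundaryOn (W ∩ discComplement Z) c) :
    ∃ a, IsLocalPeriod Z c b₁ x a := by
  obtain ⟨b, hb⟩ := hc
  obtain ⟨V₀, hV₀, D, hD, hVD⟩ := mem_nhds_prod_iff.1 (hW.mem_nhds hx)
  obtain ⟨V, ⟨hVo, hxV, hVc⟩, hVV⟩ := (isOpen_isPathConnected_basis x).mem_iff.1 hV₀
  obtain ⟨δ, hδ, hδD⟩ := Metric.nhds_basis_closedBall.mem_iff.1 hD
  have hε : 0 < min δ 1 := lt_min hδ one_pos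
  have hprim : ∀ τ : SingSimplex 2 (M × ℂ),
      (∀ t, (τ t).1 ∈ V ∧ ‖(τ t).2‖ ≤ min δ 1 ∧ ((τ t).2 = 0 → (τ t).1 ∉ Z)) →
      singCoboundary 1 (M × ℂ) A b τ = c τ := by
    refine fun τ h => hb τ fun t => ⟨hVD ⟨hVV (h t).1, hδD ?_⟩,
      (h t).2.1.trans (min_le_right _ _), (h t).2.2⟩
    simpa using (h t).2.1.trans (min_le_left _ _)
  have hz : IsCocycleOn 1 {q : M × ℂ | q.1 ∈ V ∧ q.2 ≠ 0 ∧ ‖q.2‖ ≤ min δ 1} (b₁ - b) :=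
    isCocycleOn_sub (fun τ h => hb₁ τ fun t => ⟨(h t).2.1, (h t).2.2.trans (min_le_right _ _)⟩)
      (fun τ h => hprim τ fun t => ⟨(h t).1, (h t).2.2, fun h0 => absurd h0 (h t).2.1⟩)
  refine ⟨(b₁ - b) (fibreLoop x (min δ 1)), V, min δ 1, b, hVo, hxV, hε, min_le_right _ _, hprim, fun y hy r h0 h1 => ?_⟩
  obtain ⟨η, hη⟩ := hVc.joinedIn y hy x hxV
  refine hz.fibreLoop_eq η r (min δ 1) fun s θ => ?_
  have hs : (AffineMap.lineMap r (min δ 1) (s : ℝ) : ℝ) ∈ Set.Ioc 0 (min δ 1) :=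
    (convex_Ioc 0 (min δ 1)).lineMap_mem ⟨h0, h1⟩ ⟨hε, le_rfl⟩ s.2
  refine ⟨hη s, norm_pos_iff.1 ?_, ?_⟩
  · rw [norm_ofReal_mul_circle hs.1.le]; exact hs.1
  · rw [norm_ofReal_mul_circle hs.1.le]; exact hs.2

/-- The difference is a cocycle on the whole fibre disc, where the loop shrinks to a constant. -/
theorem fibreLoop_eq_of_primitives {b b' : SingSimplex 1 (M × ℂ) → A} {y : M} {ε : ℝ} (hε : 0 ≤ ε)
    (hb : ∀ τ : SingSimplex 2 (M × ℂ), (∀ t, (τ t).1 = y ∧ ‖(τ t).2‖ ≤ ε) →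
      singCoboundary 1 (M × ℂ) A b τ = c τ)
    (hb' : ∀ τ : SingSimplex 2 (M × ℂ), (∀ t, (τ t).1 = y ∧ ‖(τ t).2‖ ≤ ε) →
      singCoboundary 1 (M × ℂ) A b' τ = c τ) :
    b (fibreLoop y ε) = b' (fibreLoop y ε) := by
  have hz : IsCocycleOn 1 {q : M × ℂ | q.1 = y ∧ ‖q.2‖ ≤ ε} (b - b') := isCocycleOn_sub hb hb'
  have h := hz.fibreLoop_eq (Path.refl y) ε 0 fun s θ => by
    have hs : (AffineMap.lineMap ε 0 (s : ℝ) : ℝ) ∈ Set.Icc 0 ε :=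
      (convex_Icc 0 ε).lineMap_mem ⟨hε, le_rfl⟩ ⟨le_rfl, hε⟩ s.2
    refine ⟨rfl, ?_⟩
    rw [norm_ofReal_mul_circle hs.1]
    exact hs.2
  rw [fibreLoop_zero, hz.const_eq_zero ⟨rfl, by simpa using hε⟩] at h
  exact sub_eq_zero.1 h

theorem IsLocalPeriod.unique (hdense : Dense Zᶜ) {x : M} {a a' : A}
    (h : IsLocalPeriod Z c b₁ x a) (h' : IsLocalPeriod Z c b₁ x a') : a = a' := by
  obtain ⟨V, ε, b, hV, hx, hε, -, hb, hper⟩ := h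
  obtain ⟨V', ε', b', hV', hx', hε', -, hb', hper'⟩ := h'
  -- Over a nearby point outside `Z` both local primitives are defined on a full fibre disc and can
  -- be compared, even when `x` itself lies in `Z`.
  obtain ⟨y, ⟨hy, hy'⟩, hyZ⟩ := hdense.inter_open_nonempty _ (hV.inter hV') ⟨x, hx, hx'⟩
  have hδ : 0 < min ε ε' := lt_min hε hε'
  have e := fibreLoop_eq_of_primitives (c := c) (b := b) (b' := b') (y := y) hδ.le
    (fun τ h => hb τ fun t => ⟨(h t).1 ▸ hy, (h t).2.trans (min_le_left _ _),
      fun _ => (h t).1 ▸ hyZ⟩)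
    (fun τ h => hb' τ fun t => ⟨(h t).1 ▸ hy', (h t).2.trans (min_le_right _ _),
      fun _ => (h t).1 ▸ hyZ⟩)
  rw [← hper y hy _ hδ (min_le_left _ _), ← hper' y hy' _ hδ (min_le_right _ _), Pi.sub_apply,
    Pi.sub_apply, e]

theorem IsLocalPeriod.eventually {x : M} {a : A} (h : IsLocalPeriod Z c b₁ x a) :
    ∀ᶠ y in 𝓝 x, IsLocalPeriod Z c b₁ y a := by
  obtain ⟨V, ε, b, hV, hx, h⟩ := h
  filter_upwards [hV.mem_nhds hx] with y hy
  exact ⟨V, ε, b, hV, hy, h⟩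

/-- The primitive over the punctured discs can be chosen such that all its local periods vanish. -/
theorem exists_primitive_without_periods [LocallyPathConnectedSpace M] (hdense : Dense Zᶜ)
    (hc : IsCocycleOn 2 (discComplement Z) c) (hbd : IsCoboundaryOn {q : M × ℂ | ‖q.2‖ = 1} c)
    (hloc : ∀ x, ∃ W : Set (M × ℂ), IsOpen W ∧ (x, 0) ∈ W ∧
      IsCoboundaryOn (W ∩ discComplement Z) c) :
    ∃ b : SingSimplex 1 (M × ℂ) → A,
      (∀ τ : SingSimplex 2 (M × ℂ), (∀ t, τ t ∈ puncturedDiscs M) →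
        singCoboundary 1 (M × ℂ) A b τ = c τ) ∧
      ∀ y ∉ Z, ∀ b' : SingSimplex 1 (M × ℂ) → A,
        (∀ τ : SingSimplex 2 (M × ℂ), (∀ t, (τ t).1 = y ∧ ‖(τ t).2‖ ≤ 1) →
          singCoboundary 1 (M × ℂ) A b' τ = c τ) → (b - b') (fibreLoop y 1) = 0 := by
  obtain ⟨b₁, hb₁⟩ := isCoboundaryOn_puncturedDiscs (hc.mono (puncturedDiscs_subset Z)) hbd
  have hex : ∀ x, ∃ a, IsLocalPeriod Z c b₁ x a := fun x =>
    let ⟨_, hW, hx, h⟩ := hloc x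
    exists_isLocalPeriod hb₁ hW hx h
  choose α hα using hex
  have hαc : IsLocallyConstant α := (IsLocallyConstant.iff_eventually_eq α).2 fun x => by
    filter_upwards [(hα x).eventually] with y hy
    exact (hα y).unique hdense hy
  obtain ⟨κ, hκ, hκα⟩ := exists_weighted_winding hαc
  refine ⟨b₁ - κ, fun τ h => ?_, fun y hy b' hb' => ?_⟩
  · rw [map_sub, Pi.sub_apply, hb₁ τ h, hκ τ h, sub_zero]
  -- The local primitive `b` lives only on a disc of radius `ε`: `e` compares it with `b'` there,
  -- and `e'` carries the period of `b₁ - b'` from radius 1 to radius `ε`.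
  · obtain ⟨V, ε, b, hV, hyV, hε, hε1, hb, hper⟩ := hα y
    have e := fibreLoop_eq_of_primitives (c := c) (b := b) (b' := b') (y := y) hε.le
      (fun τ h => hb τ fun t => ⟨(h t).1 ▸ hyV, (h t).2, fun _ => (h t).1 ▸ hy⟩)
      (fun τ h => hb' τ fun t => ⟨(h t).1, (h t).2.trans hε1⟩)
    have hz : IsCocycleOn 1 {q : M × ℂ | q.1 = y ∧ q.2 ≠ 0 ∧ ‖q.2‖ ≤ 1} (b₁ - b') :=
      isCocycleOn_sub (fun τ h => hb₁ τ fun t => (h t).2)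
        (fun τ h => hb' τ fun t => ⟨(h t).1, (h t).2.2⟩)
    have e' := hz.fibreLoop_eq (Path.refl y) 1 ε fun s θ => by
      have hs : (AffineMap.lineMap 1 ε (s : ℝ) : ℝ) ∈ Set.Ioc 0 1 :=
        (convex_Ioc 0 1).lineMap_mem ⟨one_pos, le_rfl⟩ ⟨hε, hε1⟩ s.2
      refine ⟨rfl, norm_pos_iff.1 ?_, ?_⟩
      · rw [norm_ofReal_mul_circle hs.1.le]; exact hs.1
      · rw [norm_ofReal_mul_circle hs.1.le]; exact hs.2
    have h1 := hper y hyV ε hε le_rfl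
    have h2 := hκα y 1 one_pos le_rfl
    simp only [Pi.sub_apply] at e' h1 ⊢
    rw [sub_right_comm, e', ← e, h1, h2, sub_self]

/-- A 2-cocycle on `M × D² ∖ Z × {0}`, where `M ∖ Z` is a disjoint union of open cells, is a
coboundary if it is a coboundary over the boundary `M × S¹` and near every point of `Z × {0}`. -/
theorem isCoboundaryOn_discComplement [LocallyPathConnectedSpace M] {V : Type*}
    [NormedAddCommGroup V] [NormedSpace ℝ V] {ι : Type*} (e : ι → PartialEquiv V M)
    (hconv : ∀ i, Convex ℝ (e i).source) (hcont : ∀ i, ContinuousOn (e i) (e i).source)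
    (hcont' : ∀ i, ContinuousOn (e i).symm (e i).target) (hopen : ∀ i, IsOpen (e i).target)
    (hdisj : ∀ i j x, x ∈ (e i).target → x ∈ (e j).target → i = j)
    (hcover : ∀ x, x ∉ Z ↔ ∃ i, x ∈ (e i).target) (hdense : Dense Zᶜ)
    (hc : IsCocycleOn 2 (discComplement Z) c) (hbd : IsCoboundaryOn {q : M × ℂ | ‖q.2‖ = 1} c)
    (hloc : ∀ x ∈ Z, ∃ W : Set (M × ℂ), IsOpen W ∧ (x, 0) ∈ W ∧
      IsCoboundaryOn (W ∩ discComplement Z) c) :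
    IsCoboundaryOn (discComplement Z) c := by
  classical
  have hcell : ∀ i, {q : M × ℂ | q.1 ∈ (e i).target ∧ ‖q.2‖ ≤ 1} ⊆ discComplement Z :=
    fun i q hq => ⟨hq.2, fun _ => (hcover _).2 ⟨i, hq.1⟩⟩
  have hcob : ∀ i, IsCoboundaryOn {q : M × ℂ | q.1 ∈ (e i).target ∧ ‖q.2‖ ≤ 1} c := fun i =>
    isCoboundaryOn_cell (e i) (hconv i) (hcont i) (hcont' i) (hc.mono (hcell i))
  have hloc' : ∀ x, ∃ W : Set (M × ℂ), IsOpen W ∧ (x, 0) ∈ W ∧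
      IsCoboundaryOn (W ∩ discComplement Z) c := by
    intro x
    by_cases hx : x ∈ Z
    · exact hloc x hx
    · obtain ⟨i, hi⟩ := (hcover x).1 hx
      refine ⟨Prod.fst ⁻¹' (e i).target, (hopen i).preimage continuous_fst, hi, (hcob i).mono ?_⟩
      exact fun q hq => ⟨hq.1, hq.2.1⟩
  obtain ⟨b₁, hb₁, hper⟩ := exists_primitive_without_periods hdense hc hbd hloc'
  choose b hb using hcob
  have hprim : ∀ i, ∃ g : M × ℂ → A, ∀ γ : SingSimplex 1 (M × ℂ),
      (∀ t, (γ t).1 ∈ (e i).target ∧ (γ t).2 ≠ 0 ∧ ‖(γ t).2‖ ≤ 1) →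
      (b₁ - b i) γ = g (γ (stdSimplex.vertex 1)) - g (γ (stdSimplex.vertex 0)) := by
    intro i
    have hz : IsCocycleOn 1 {q : M × ℂ | q.1 ∈ (e i).target ∧ q.2 ≠ 0 ∧ ‖q.2‖ ≤ 1} (b₁ - b i) :=
      isCocycleOn_sub (c := c) (fun τ h => hb₁ τ fun t => (h t).2)
        (fun τ h => hb i τ fun t => ⟨(h t).1, (h t).2.2⟩)
    refine hz.exists_primitive (e i) (hconv i) (hcont i) (hcont' i) fun y hy => ?_
    exact hper y ((hcover y).2 ⟨i, hy⟩) _ fun τ h => hb i τ fun t => ⟨(h t).1 ▸ hy, (h t).2⟩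
  choose g hg using hprim
  -- The glued cochain: `b₁` on the punctured discs and `b i` plus the coboundary of `g i` over the
  -- `i`-th cell. The two formulas agree on the overlap by `hg`; disjointness of the cells makes the
  -- chosen index irrelevant.
  let β : SingSimplex 1 (M × ℂ) → A := fun γ =>
    if ∀ t, γ t ∈ puncturedDiscs M then b₁ γ
    else if h : ∃ i, ∀ t, (γ t).1 ∈ (e i).target ∧ ‖(γ t).2‖ ≤ 1 then
      b h.choose γ + (g h.choose (γ (stdSimplex.vertex 1)) - g h.choose (γ (stdSimplex.vertex 0)))
    else 0
  have hβ₁ : ∀ γ : SingSimplex 1 (M × ℂ), (∀ t, γ t ∈ puncturedDiscs M) → β γ = b₁ γ :=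
    fun γ h => if_pos h
  have hβ : ∀ i (γ : SingSimplex 1 (M × ℂ)), (∀ t, (γ t).1 ∈ (e i).target ∧ ‖(γ t).2‖ ≤ 1) →
      β γ = b i γ + (g i (γ (stdSimplex.vertex 1)) - g i (γ (stdSimplex.vertex 0))) := by
    intro i γ h
    by_cases h1 : ∀ t, γ t ∈ puncturedDiscs M
    · rw [hβ₁ γ h1, ← hg i γ fun t => ⟨(h t).1, h1 t⟩, Pi.sub_apply, add_sub_cancel]
    · have h2 : ∃ i, ∀ t, (γ t).1 ∈ (e i).target ∧ ‖(γ t).2‖ ≤ 1 := ⟨i, h⟩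
      have h3 : h2.choose = i :=
        hdisj _ _ _ (h2.choose_spec (stdSimplex.vertex 0)).1 (h (stdSimplex.vertex 0)).1
      simp only [β]
      rw [if_neg h1, dif_pos h2, h3]
  have hδ₁ : ∀ τ : SingSimplex 2 (M × ℂ), (∀ t, τ t ∈ puncturedDiscs M) →
      singCoboundary 1 (M × ℂ) A β τ = c τ := by
    intro τ h
    rw [← hb₁ τ h, singCoboundary_one_apply, singCoboundary_one_apply, hβ₁ _ fun t => h _,
      hβ₁ _ fun t => h _, hβ₁ _ fun t => h _]
  have hδ : ∀ i (τ : SingSimplex 2 (M × ℂ)), (∀ t, (τ t).1 ∈ (e i).target ∧ ‖(τ t).2‖ ≤ 1) →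
      singCoboundary 1 (M × ℂ) A β τ = c τ := by
    intro i τ h
    have hv : ∀ (j : Fin 3) (l : Fin 2), (τ.comp (simplexFace 1 j)) (stdSimplex.vertex l)
        = τ (stdSimplex.vertex (j.succAbove l)) := fun j l => by
      rw [ContinuousMap.comp_apply, simplexFace_vertex]
    rw [← hb i τ h, singCoboundary_one_apply, singCoboundary_one_apply, hβ i _ fun t => h _,
      hβ i _ fun t => h _, hβ i _ fun t => h _]
    simp only [hv]
    have s01 : (0 : Fin 3).succAbove (1 : Fin 2) = 2 := rfl
    have s00 : (0 : Fin 3).succAbove (0 : Fin 2) = 1 := rfl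
    have s11 : (1 : Fin 3).succAbove (1 : Fin 2) = 2 := rfl
    have s10 : (1 : Fin 3).succAbove (0 : Fin 2) = 0 := rfl
    have s21 : (2 : Fin 3).succAbove (1 : Fin 2) = 1 := rfl
    have s20 : (2 : Fin 3).succAbove (0 : Fin 2) = 0 := rfl
    rw [s01, s00, s11, s10, s21, s20]
    abel
  -- A point with nonzero disc coordinate has a neighborhood in the punctured discs, any other point
  -- of the complement one over an open cell; on simplices inside either, the error is zero.
  have hlast : IsCoboundaryOn (discComplement Z) (c - singCoboundary 1 (M × ℂ) A β) := by
    refine isCoboundaryOn_of_locally_zero (fun σ h => ?_) fun q hq => ?_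
    · rw [map_sub, Pi.sub_apply, hc σ h, singCoboundary_singCoboundary]
      simp
    · by_cases h0 : q.2 = 0
      · obtain ⟨i, hi⟩ := (hcover _).1 (hq.2 h0)
        exact ⟨Prod.fst ⁻¹' (e i).target, (hopen i).preimage continuous_fst, hi, fun σ h =>
          sub_eq_zero.2 (hδ i σ fun t => ⟨(h t).1, (h t).2.1⟩).symm⟩
      · exact ⟨{q | q.2 ≠ 0}, isOpen_ne.preimage continuous_snd, h0, fun σ h =>
          sub_eq_zero.2 (hδ₁ σ fun t => ⟨(h t).1, (h t).2.1⟩).symm⟩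
  obtain ⟨b', hb'⟩ := hlast
  refine ⟨b' + β, fun τ h => ?_⟩
  rw [map_add, Pi.add_apply, hb' τ h, Pi.sub_apply, sub_add_cancel]

end Core

/-! ### Open maximal cells -/

section CellStructures

open Topology Topology.RelCWComplex

variable {n : ℕ} {M : Type*} [TopologicalSpace M] [T2Space M] [CWComplex (Set.univ : Set M)]

omit [T2Space M] in
theorem target_eq_openCell {k : ℕ} (a : cell (Set.univ : Set M) k) :
    (RelCWComplex.map k a).target = openCell k a := by
  rw [← (RelCWComplex.map k a).image_source_eq_target, RelCWComplex.source_eq]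
  rfl

theorem notMem_skeletonLT_iff (hdim : ∀ k, n ≤ k → IsEmpty (cell (Set.univ : Set M) k))
    (hn : 1 ≤ n) (x : M) :
    x ∉ (skeletonLT (Set.univ : Set M) ((n - 1 : ℕ) : ℕ∞) : Set M) ↔
      ∃ a : cell (Set.univ : Set M) (n - 1), x ∈ openCell (n - 1) a := by
  rw [SetLike.mem_coe, CWComplex.mem_skeletonLT_iff]
  constructor
  · intro h
    have hx : x ∈ ⋃ (k : ℕ) (a : cell (Set.univ : Set M) k), openCell k a := by
      rw [CWComplex.iUnion_openCell_eq_complex]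
      trivial
    obtain ⟨k, a, ha⟩ := Set.mem_iUnion₂.1 hx
    have h1 : k < n := by
      by_contra hk
      exact (hdim k (not_lt.1 hk)).elim a
    have h2 : ¬ k < n - 1 := fun hk => h ⟨k, by exact_mod_cast hk, a, ha⟩
    obtain rfl : k = n - 1 := by omega
    exact ⟨a, ha⟩
  · rintro ⟨a, ha⟩ ⟨k, hk, b, hb⟩
    have := eq_of_not_disjoint_openCell (Set.not_disjoint_iff.2 ⟨x, ha, hb⟩)
    have hk' : k < n - 1 := by exact_mod_cast hk
    have := congrArg Sigma.fst this
    simp only at this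
    omega

omit [T2Space M] in
theorem eq_of_mem_openCell {k : ℕ} {a b : cell (Set.univ : Set M) k} {x : M}
    (ha : x ∈ openCell k a) (hb : x ∈ openCell k b) : a = b := by
  have := eq_of_not_disjoint_openCell (Set.not_disjoint_iff.2 ⟨x, ha, hb⟩)
  simpa using this

/-- The complement meets each closed cell in a closed set: the frontier for the cell itself, and the
whole closed cell otherwise, since frontiers lie in cells of dimension below `n - 1`. -/
theorem isOpen_openCell_of_top (hdim : ∀ k, n ≤ k → IsEmpty (cell (Set.univ : Set M) k))
    (a : cell (Set.univ : Set M) (n - 1)) : IsOpen (openCell (n - 1) a) := by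
  rw [← isClosed_compl_iff]
  refine CWComplex.isClosed_of_isClosed_inter_openCell_or_isClosed_inter_closedCell
    (Set.subset_univ _) fun k _ b => Or.inr ?_
  have hk : k ≤ n - 1 := by
    by_contra hk
    exact (hdim k (by omega)).elim b
  by_cases h : (⟨k, b⟩ : Σ k, cell (Set.univ : Set M) k) = ⟨n - 1, a⟩
  · obtain ⟨rfl, h⟩ := Sigma.mk.inj h
    obtain rfl := eq_of_heq h
    have : (openCell _ b)ᶜ ∩ closedCell _ b = cellFrontier _ b := by
      rw [← cellFrontier_union_openCell_eq_closedCell, Set.inter_union_distrib_left,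
        Set.compl_inter_self, Set.union_empty, Set.inter_eq_right]
      intro x hx hx'
      obtain ⟨l, hl, j, hj⟩ := CWComplex.mem_skeletonLT_iff.1
        (cellFrontier_subset_skeletonLT _ b hx)
      have e := congrArg Sigma.fst
        (eq_of_not_disjoint_openCell (Set.not_disjoint_iff.2 ⟨x, hx', hj⟩))
      have hl' := Nat.cast_lt.1 hl
      simp only at e
      omega
    rw [this]
    exact isClosed_cellFrontier
  · have : (openCell (n - 1) a)ᶜ ∩ closedCell k b = closedCell k b := by
      rw [Set.inter_eq_right, ← cellFrontier_union_openCell_eq_closedCell]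
      rintro x (hx | hx) hx'
      · obtain ⟨l, hl, j, hj⟩ := CWComplex.mem_skeletonLT_iff.1
          (cellFrontier_subset_skeletonLT _ b hx)
        have e := congrArg Sigma.fst
          (eq_of_not_disjoint_openCell (Set.not_disjoint_iff.2 ⟨x, hx', hj⟩))
        have hl' := Nat.cast_lt.1 hl
        simp only at e
        omega
      · exact h (eq_of_not_disjoint_openCell (Set.not_disjoint_iff.2 ⟨x, hx, hx'⟩))
    rw [this]
    exact isClosed_closedCell

/-- The open maximal cells of a simple cell structure are dense. -/
theorem IsSimpleCellStructure.dense (hM : IsSimpleCellStructure n M) (hn : 1 ≤ n) :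
    Dense (skeletonLT (Set.univ : Set M) ((n - 1 : ℕ) : ℕ∞) : Set M)ᶜ := by
  intro x
  have hx : x ∈ ⋃ (k : ℕ) (a : cell (Set.univ : Set M) k), closedCell k a := by
    rw [CWComplex.union]
    trivial
  obtain ⟨k, a, ha⟩ := Set.mem_iUnion₂.1 hx
  have hk : k < n := by
    by_contra hk
    exact (hM.dim_lt k (not_lt.1 hk)).elim a
  have hcard := hM.simple k hk a
  -- The number `n - k` of maximal cells containing the given cell is positive.
  obtain ⟨⟨b, hb⟩⟩ : Nonempty {b : cell (Set.univ : Set M) (n - 1) //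
      closedCell k a ⊆ closedCell (n - 1) b} := by
    by_contra h
    rw [not_nonempty_iff] at h
    rw [Nat.card_of_isEmpty] at hcard
    omega
  have hxb : x ∈ closure (openCell (n - 1) b) := by
    rw [closure_openCell_eq_closedCell]
    exact hb ha
  exact closure_mono (fun y hy => (notMem_skeletonLT_iff hM.dim_lt hn y).2 ⟨b, hy⟩) hxb

end CellStructures

/-! ### From characteristic data to cochains -/

section CharacteristicData

open Topology

variable {n : ℕ} [NeZero n] {M : Type*} [TopologicalSpace M] [T2Space M]
  [CWComplex (Set.univ : Set M)] {X : Type*} [TopologicalSpace X]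
  [ChartedSpace (EuclideanHalfSpace (2 * n)) X] [MulAction (Torus (n - 1)) X]

/-- The Euler class restricts to zero over the boundary when the bundle is trivial there. -/
theorem HasCharacteristicData.exists_boundary_primitive
    {h : MulAction.orbitRel.Quotient (Torus (n - 1)) X ≃ₜ M × Disc}
    {μ : RelCWComplex.cell (Set.univ : Set M) (n - 2) → (Fin (n - 1) → ℤ)}
    {e : SingH2 ((skeletonSponge n M)ᶜ : Set (M × Disc)) (Fin (n - 1) → ℤ)}
    (hdata : HasCharacteristicData n h μ e) (htriv : IsTrivialOverBoundary n h) :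
    ∃ c : SingCocycle2 ((skeletonSponge n M)ᶜ : Set (M × Disc)) (Fin (n - 1) → ℤ),
      QuotientAddGroup.mk c = e ∧
      ∃ β : SingSimplex 1 ((skeletonSponge n M)ᶜ : Set (M × Disc)) → (Fin (n - 1) → ℤ),
        ∀ τ : SingSimplex 2 ((skeletonSponge n M)ᶜ : Set (M × Disc)),
          (∀ t, ‖((τ t : M × Disc).2 : ℂ)‖ = 1) → singCoboundary 1 _ _ β τ = c.1 τ := by
  classical
  obtain ⟨c, hc, hce⟩ := hdata.euler
  obtain ⟨Φ, hΦ, hΦt⟩ := htriv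
  -- The torus coordinate of the trivialization; the value 1 away from the boundary plays no role,
  -- as `ψ` is only used over `‖q.2‖ = 1`.
  let ψ : X → Torus (n - 1) := fun x =>
    if hx : x ∈ (𝓡∂ (2 * n)).boundary X then (Φ.symm ⟨x, hx⟩).2 else 1
  have hψ : ∀ x (hx : x ∈ (𝓡∂ (2 * n)).boundary X), ψ x = (Φ.symm ⟨x, hx⟩).2 := fun x hx =>
    dif_pos hx
  refine ⟨c, hce, hc.exists_coboundary (D := {q : M × Disc | ‖(q.2 : ℂ)‖ = 1}) ψ ?_ fun t x hx => ?_⟩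
  · rw [continuousOn_iff_continuous_domRestrict]
    have hmem : ∀ x : orbitProj h ⁻¹' {q : M × Disc | ‖(q.2 : ℂ)‖ = 1}, x.1 ∈ (𝓡∂ (2 * n)).boundary X :=
      fun x => (hdata.boundary x).2 x.2
    have : (orbitProj h ⁻¹' {q : M × Disc | ‖(q.2 : ℂ)‖ = 1}).domRestrict ψ
        = fun x => (Φ.symm ⟨x.1, hmem x⟩).2 := funext fun x => hψ _ (hmem x)
    rw [this]
    exact continuous_snd.comp (Φ.symm.continuous.comp (continuous_subtype_val.subtype_mk _))
  · have hx' : x ∈ (𝓡∂ (2 * n)).boundary X := (hdata.boundary x).2 hx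
    obtain ⟨⟨b, u⟩, hbu⟩ := Φ.surjective ⟨x, hx'⟩
    have hux : (Φ (b, u) : X) = x := congrArg Subtype.val hbu
    have htx : (Φ (b, t * u) : X) = t • x := by rw [hΦt, hux]
    have htx' : t • x ∈ (𝓡∂ (2 * n)).boundary X := htx ▸ (Φ (b, t * u)).2
    rw [hψ _ hx', hψ _ htx', ← hbu, Φ.symm_apply_apply]
    have : (⟨t • x, htx'⟩ : (𝓡∂ (2 * n)).boundary X) = Φ (b, t * u) := Subtype.ext htx.symm
    rw [this, Φ.symm_apply_apply]

/-- The inclusion of the complement of the sponge into `M × ℂ`. -/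
def spongeComplementInclusion (n : ℕ) (M : Type*) [TopologicalSpace M] [T2Space M]
    [CWComplex (Set.univ : Set M)] : C(((skeletonSponge n M)ᶜ : Set (M × Disc)), M × ℂ) :=
  ⟨fun q => (q.1.1, q.1.2), by fun_prop⟩

theorem isEmbedding_spongeComplementInclusion (n : ℕ) (M : Type*) [TopologicalSpace M] [T2Space M]
    [CWComplex (Set.univ : Set M)] : IsEmbedding (spongeComplementInclusion n M) :=
  (IsEmbedding.id.prodMap IsEmbedding.subtypeVal).comp IsEmbedding.subtypeVal

theorem range_spongeComplementInclusion (n : ℕ) (M : Type*) [TopologicalSpace M] [T2Space M]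
    [CWComplex (Set.univ : Set M)] : Set.range (spongeComplementInclusion n M)
      = discComplement (RelCWComplex.skeletonLT (Set.univ : Set M) ((n - 1 : ℕ) : ℕ∞) : Set M) := by
  ext q
  constructor
  · rintro ⟨x, rfl⟩
    exact ⟨mem_closedBall_zero_iff.1 x.1.2.2, fun h0 hx => x.2 ⟨hx, h0⟩⟩
  · rintro ⟨h1, h2⟩
    exact ⟨⟨(q.1, ⟨q.2, by simpa using h1⟩), fun hq => h2 hq.2 hq.1⟩, rfl⟩

end CharacteristicData

/-- Stated for one cocycle, later the difference of two. It is moved to `M × ℂ` by extension by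
zero, so that `isCoboundaryOn_discComplement` applies with the characteristic maps of the maximal
cells. -/
theorem eq_of_localClass_eq {n : ℕ} [NeZero n] {M : Type*} [TopologicalSpace M] [T2Space M]
    [LocallyPathConnectedSpace M] [Topology.CWComplex (Set.univ : Set M)]
    (hM : IsSimpleCellStructure n M) {A : Type*} [AddCommGroup A]
    (c : SingCocycle2 ((skeletonSponge n M)ᶜ : Set (M × Disc)) A)
    (β : SingSimplex 1 ((skeletonSponge n M)ᶜ : Set (M × Disc)) → A)
    (hβ : ∀ τ : SingSimplex 2 ((skeletonSponge n M)ᶜ : Set (M × Disc)),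
      (∀ t, ‖((τ t : M × Disc).2 : ℂ)‖ = 1) → singCoboundary 1 _ _ β τ = c.1 τ)
    (hlocal : ∀ x ∈ skeletonSponge n M, ∃ W : Set (M × Disc), IsOpen W ∧ x ∈ W ∧
      ∃ β : SingSimplex 1 ((skeletonSponge n M)ᶜ : Set (M × Disc)) → A,
        ∀ τ : SingSimplex 2 ((skeletonSponge n M)ᶜ : Set (M × Disc)), (∀ t, (τ t).1 ∈ W) →
          singCoboundary 1 _ _ β τ = c.1 τ) :
    (QuotientAddGroup.mk c : SingH2 ((skeletonSponge n M)ᶜ : Set (M × Disc)) A) = 0 := by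
  have hn : 1 ≤ n := NeZero.one_le
  set j := spongeComplementInclusion n M
  have hj := isEmbedding_spongeComplementInclusion n M
  have hrange := range_spongeComplementInclusion n M
  have hlift : ∀ {k : ℕ} (σ : SingSimplex k (M × ℂ)), (∀ t, σ t ∈ discComplement
      (Topology.RelCWComplex.skeletonLT (Set.univ : Set M) ((n - 1 : ℕ) : ℕ∞) : Set M)) →
      ∃ σ₀, j.comp σ₀ = σ := fun σ h => exists_lift_of_isEmbedding hj σ (by rwa [hrange])
  have hcell : ∀ a, (Topology.RelCWComplex.map (C := (Set.univ : Set M)) (n - 1) a).source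
      = Metric.ball 0 1 := fun a => Topology.RelCWComplex.source_eq _ a
  have key : IsCoboundaryOn (discComplement (Topology.RelCWComplex.skeletonLT (Set.univ : Set M)
      ((n - 1 : ℕ) : ℕ∞) : Set M)) (extendCochain j c.1) := by
    refine isCoboundaryOn_discComplement
      (fun a => Topology.RelCWComplex.map (C := (Set.univ : Set M)) (n - 1) a)
      (fun a => by rw [hcell]; exact convex_ball _ _)
      (fun a => by
        rw [hcell]
        exact (Topology.RelCWComplex.continuousOn _ a).mono Metric.ball_subset_closedBall)
      (fun a => Topology.RelCWComplex.continuousOn_symm _ a)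
      (fun a => by rw [target_eq_openCell]; exact isOpen_openCell_of_top hM.dim_lt a)
      (fun a b x ha hb => by
        rw [target_eq_openCell] at ha hb
        exact eq_of_mem_openCell ha hb)
      (fun x => by
        simp only [target_eq_openCell]
        exact notMem_skeletonLT_iff hM.dim_lt hn x)
      (hM.dense hn) (fun σ h => ?_) ⟨extendCochain j β, fun τ h => ?_⟩ fun x hx => ?_
    · obtain ⟨σ, rfl⟩ := hlift σ h
      rw [singCoboundary_extendCochain hj.injective]
      exact congrFun c.2 σ
    · obtain ⟨τ, rfl⟩ := hlift τ fun t => ⟨(h t).le, fun h0 => by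
        have := h t
        rw [Set.mem_ofPred_eq, h0] at this
        simp at this⟩
      rw [singCoboundary_extendCochain hj.injective, extendCochain_comp hj.injective]
      exact hβ τ h
    · obtain ⟨W, hW, hxW, β', hβ'⟩ := hlocal (x, ⟨0, by simp⟩) ⟨hx, rfl⟩
      have hemb : Topology.IsEmbedding (Prod.map id Subtype.val : M × Disc → M × ℂ) :=
        Topology.IsEmbedding.id.prodMap Topology.IsEmbedding.subtypeVal
      obtain ⟨W', hW', rfl⟩ := hemb.isInducing.isOpen_iff.1 hW
      refine ⟨W', hW', hxW, extendCochain j β', fun τ h => ?_⟩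
      obtain ⟨τ, rfl⟩ := hlift τ fun t => (h t).2
      rw [singCoboundary_extendCochain hj.injective, extendCochain_comp hj.injective]
      exact hβ' τ fun t => (h t).1
  obtain ⟨b, hb⟩ := key
  rw [QuotientAddGroup.eq_zero_iff, AddSubgroup.mem_addSubgroupOf]
  refine ⟨fun σ => b (j.comp σ), funext fun τ => ?_⟩
  rw [← extendCochain_comp hj.injective c.1 τ, ← hb (j.comp τ) fun t => hrange ▸ Set.mem_range_self _]
  rfl

/-- Equality in the direct limit is equality after restriction to some `W \ Z`; a primitive of the
difference there, extended by zero, serves for all simplices inside `W`. -/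
theorem exists_local_primitive_of_localClass_eq {Q : Type*} [TopologicalSpace Q] {Z : Set Q}
    {A : Type*} [AddCommGroup A] (c c' : SingCocycle2 (Zᶜ : Set Q) A) (x : Q)
    (h : localClass (QuotientAddGroup.mk c : SingH2 (Zᶜ : Set Q) A) x
      = localClass (QuotientAddGroup.mk c') x) :
    ∃ W : Set Q, IsOpen W ∧ x ∈ W ∧ ∃ β : SingSimplex 1 (Zᶜ : Set Q) → A,
      ∀ τ : SingSimplex 2 (Zᶜ : Set Q), (∀ t, (τ t).1 ∈ W) →
        singCoboundary 1 _ _ β τ = (c - c').1 τ := by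
  obtain ⟨⟨W, hW, hx⟩, ha, hb, hab⟩ := Quotient.exact h
  let j : C((W \ Z : Set Q), (Zᶜ : Set Q)) :=
    ⟨Set.inclusion fun _ h => h.2, continuous_inclusion _⟩
  have hab : (QuotientAddGroup.mk (pullCocycle2 j c) : SingH2 (W \ Z : Set Q) A)
      = QuotientAddGroup.mk (pullCocycle2 j c') := hab
  rw [← sub_eq_zero, ← QuotientAddGroup.mk_sub, QuotientAddGroup.eq_zero_iff] at hab
  rw [AddSubgroup.mem_addSubgroupOf] at hab
  obtain ⟨b, hb⟩ := hab
  have hj : Topology.IsEmbedding j := Topology.IsEmbedding.inclusion fun _ h => h.2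
  refine ⟨W, hW, hx, extendCochain j b, fun τ hτ => ?_⟩
  obtain ⟨τ, rfl⟩ := exists_lift_of_isEmbedding hj τ fun t => ⟨⟨(τ t).1, hτ t, (τ t).2⟩, rfl⟩
  rw [singCoboundary_extendCochain hj.injective, hb]
  rfl

theorem mainTheorem5 (n : ℕ) [NeZero n]
    {M : Type*} [TopologicalSpace M] [T2Space M] [CompactSpace M]
    [ChartedSpace (EuclideanSpace ℝ (Fin (n - 1))) M]
    [Topology.CWComplex (Set.univ : Set M)] (hM : IsSimpleCellStructure n M)
    {X : Type*} [TopologicalSpace X] [T2Space X] [CompactSpace X]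
    [ChartedSpace (EuclideanHalfSpace (2 * n)) X] [IsManifold (𝓡∂ (2 * n)) ∞ X]
    [MulAction (Torus (n - 1)) X] (hX : IsComplexityOneAction n X)
    (h : MulAction.orbitRel.Quotient (Torus (n - 1)) X ≃ₜ M × Disc)
    (μ : Topology.RelCWComplex.cell (Set.univ : Set M) (n - 2) → (Fin (n - 1) → ℤ))
    (e : SingH2 ((skeletonSponge n M)ᶜ : Set (M × Disc)) (Fin (n - 1) → ℤ))
    (hdata : HasCharacteristicData n h μ e) (htriv : IsTrivialOverBoundary n h)
    {X' : Type*} [TopologicalSpace X'] [T2Space X'] [CompactSpace X']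
    [ChartedSpace (EuclideanHalfSpace (2 * n)) X'] [IsManifold (𝓡∂ (2 * n)) ∞ X']
    [MulAction (Torus (n - 1)) X'] (hX' : IsComplexityOneAction n X')
    (h' : MulAction.orbitRel.Quotient (Torus (n - 1)) X' ≃ₜ M × Disc)
    (μ' : Topology.RelCWComplex.cell (Set.univ : Set M) (n - 2) → (Fin (n - 1) → ℤ))
    (e' : SingH2 ((skeletonSponge n M)ᶜ : Set (M × Disc)) (Fin (n - 1) → ℤ))
    (hdata' : HasCharacteristicData n h' μ' e') (htriv' : IsTrivialOverBoundary n h')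
    (hlocal : ∀ x ∈ skeletonSponge n M, localClass e x = localClass e' x) :
    e = e' := by
  have := ChartedSpace.locallyPathConnectedSpace (EuclideanSpace ℝ (Fin (n - 1))) M
  obtain ⟨c, rfl, β, hβ⟩ := hdata.exists_boundary_primitive htriv
  obtain ⟨c', rfl, β', hβ'⟩ := hdata'.exists_boundary_primitive htriv'
  have h0 := eq_of_localClass_eq hM (c - c') (β - β')
    (fun τ h => by
      rw [map_sub, Pi.sub_apply, hβ τ h, hβ' τ h]
      rfl)
    (fun x hx => exists_local_primitive_of_localClass_eq c c' x (hlocal x hx))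
  rwa [QuotientAddGroup.mk_sub, sub_eq_zero] at h0
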